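/- Let $f(x)\in\mathbb Z[x]$ be a monic polynomial of degree $n\ge 1$ with complex roots $\alpha_1,\dots,\alpha_n$ (in a fixed numbering). Let $\hat{\boldsymbol m}_j=(m_{j,1},\dots,m_{j,n},m_j)$ $(1\le j\le t)$ be a $\mathbb Z$-basis of the lattice $\{(l_1,\dots,l_{n},l_{n+1})\in\mathbb Z^{n+1}\mid \sum_{i=1}^n l_i\alpha_i=l_{n+1}\}$, and put $\boldsymbol m_j=(m_{j,1},\dots,m_{j,n})$. For $\sigma\in S_n$ let $\sigma(\boldsymbol x)=(x_{\sigma^{-1}(1)},\dots,x_{\sigma^{-1}(n)})$ for $\boldsymbol x=(x_1,\dots,x_n)$, let $\boldsymbol G$ be the group of all $\sigma\in S_n$ such that $\sigma(\boldsymbol m_1),\dots,\sigma(\boldsymbol m_t)$ span the same lattice as $\boldsymbol m_1,\dots,\boldsymbol m_t$, and let $\hat{\boldsymbol G}$ be the group of all $\sigma\in S_n$ such that the vectors $(\sigma(\boldsymbol m_j),m_j)$ span the same lattice as the $\hat{\boldsymbol m}_j$. Let $Spl_X(f)$ be the set of primes $p\le X$ modulo which $f$ is a product of linear factors. For such a $p$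 let the local roots $0\le r_1\le\dots\le r_n<p$ be the integers with $f(x)\equiv\prod_{i=1}^n(x-r_i)\bmod p$. For $\sigma\in S_n$ put $$Spl_X(f,\sigma)=\Big\{p\in Spl_X(f)\ \Big|\ \sum_{i=1}^n m_{j,i}r_{\sigma(i)}\equiv m_j \bmod p\ (1\le j\le t)\Big\},\qquad Pr(f,\sigma)=\lim_{X\to\infty}\frac{\#Spl_X(f,\sigma)}{\#Spl_X(f)},$$ where it is assumed that these limits exist for all $\sigma\in S_n$. Let $$\mathfrak D(f,\sigma)=\Big\{(x_1,\dots,x_n)\in[0,1]^n\ \Big|\ x_1\le\dots\le x_n,\ \sum_{i=1}^n m_{j,i}x_{\sigma(i)}\in\mathbb Z\ (1\le j\le t)\Big\},$$ and let $vol$ denote the $(n-t)$-dimensional volume. Consider the following two conjectures on $f$. Conjecture 1. The ratio $vol(\mathfrak D(f,\sigma))/Pr(f,\sigma)$ is the same for all $\sigma\in S_n$ with $Pr(f,\sigma)>0$; and if $\boldsymbol G=\hat{\boldsymbol G}$, then $Pr(f,\sigma)>0$ and $vol(\mathfrak D(f,\sigma))>0$ are equivalent for every $\sigma\in S_n$.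 Conjecture 2. If $n>1$, then for every $\sigma\in S_n$ with $Pr(f,\sigma)>0$ and every set $D=\overline{D^\circ}\subset[0,1)^n$ (closure and interior in $\mathbb R^n$) whose boundary satisfies $vol(\partial D\cap\mathfrak D(f,\sigma))=0$, $$\lim_{X\to\infty}\frac{\#\{p\in Spl_X(f,\sigma)\mid (r_1/p,\dots,r_n/p)\in D\}}{\#Spl_X(f,\sigma)}=\frac{vol(D\cap\mathfrak D(f,\sigma))}{vol(\mathfrak D(f,\sigma))}.$$ Theorem. Suppose that $f$ has no rational root, that $\alpha_i-\alpha_j\notin\mathbb Q$ for all distinct $i,j$, and that for every $\sigma\in S_n$ the conditions $Pr(f,\sigma)>0$ and $vol(\mathfrak D(f,\sigma))>0$ are equivalent. If Conjectures 1 and 2 hold for $f$, then the local roots of $f$ are equidistributed: for every $a\in[0,1]$, $$\lim_{X\to\infty}\frac{\sum_{p\in Spl_X(f)}\#\{i\mid 1\le i\le n,\ r_i/p\le a\}}{n\cdot\#Spl_X(f)}=a.$$ -/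

import Mathlib

open Filter Topology MeasureTheory Polynomial

namespace LocalRoots

/-! ### Linear relations among the roots

The roots of the polynomial are a family `α : Fin n → ℂ`. An element
`(l, l₀) : (Fin n → ℤ) × ℤ` encodes the integral vector `(l₁, …, lₙ, l₀)`. -/

/-- The vectors `m 1, …, m t` form a `ℤ`-basis of the lattice of all integral vectors
`(l₁, …, lₙ, l₀)` with `∑ lᵢ αᵢ = l₀`. -/
structure IsRelationBasis {n t : ℕ} (α : Fin n → ℂ) (m : Fin t → (Fin n → ℤ) × ℤ) : Prop where
  linearIndependent : LinearIndependent ℤ m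
  span_eq : (Submodule.span ℤ (Set.range m) : Set ((Fin n → ℤ) × ℤ)) =
    {l | ∑ i, (l.1 i : ℂ) * α i = (l.2 : ℂ)}

/-- The action of a permutation on vectors: `σ(x)ᵢ = x_{σ⁻¹(i)}`. -/
def permVec {n : ℕ} (σ : Equiv.Perm (Fin n)) (x : Fin n → ℤ) : Fin n → ℤ :=
  fun i => x (σ⁻¹ i)

/-- The group `Ĝ` of the permutations that preserve the lattice spanned by the vectors
`(m_{j,1}, …, m_{j,n}, m_j)`. -/
def groupHat {n t : ℕ} (m : Fin t → (Fin n → ℤ) × ℤ) : Set (Equiv.Perm (Fin n)) :=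
  {σ | Submodule.span ℤ (Set.range fun j => (permVec σ (m j).1, (m j).2)) =
    Submodule.span ℤ (Set.range m)}

/-- The group `G` of the permutations that preserve the lattice spanned by the vectors
`(m_{j,1}, …, m_{j,n})`. -/
def group {n t : ℕ} (m : Fin t → (Fin n → ℤ) × ℤ) : Set (Equiv.Perm (Fin n)) :=
  {σ | Submodule.span ℤ (Set.range fun j => permVec σ (m j).1) =
    Submodule.span ℤ (Set.range fun j => (m j).1)}

/-! ### Local roots -/

/-- `f ≡ ∏ (x - rᵢ) mod p`. -/
def FactorsMod {n : ℕ} (f : ℤ[X]) (p : ℕ) (r : Fin n → ℤ) : Prop :=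
  f.map (Int.castRingHom (ZMod p)) = ∏ i, (X - C (r i : ZMod p))

/-- `r₁, …, rₙ` are the local roots of `f` modulo `p`:
`f ≡ ∏ (x - rᵢ) mod p` and `0 ≤ r₁ ≤ ⋯ ≤ rₙ < p`. -/
structure IsLocalRoots {n : ℕ} (f : ℤ[X]) (p : ℕ) (r : Fin n → ℤ) : Prop where
  factors : FactorsMod f p r
  mono : Monotone r
  nonneg : ∀ i, 0 ≤ r i
  lt : ∀ i, r i < p

/-- A polynomial that is a product of `n` linear factors modulo a prime `p` has exactly one
system of local roots. -/
theorem FactorsMod.existsUnique {n : ℕ} {f : ℤ[X]} {p : ℕ} (hp : p.Prime)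
    {s : Fin n → ℤ} (hs : FactorsMod f p s) : ∃! r : Fin n → ℤ, IsLocalRoots f p r := by
  have hp0 : (0 : ℤ) < p := by exact_mod_cast hp.pos
  have : Fact p.Prime := ⟨hp⟩
  set s' : Fin n → ℤ := fun i => s i % p with hs'
  have hcast : ∀ i, ((s' i : ℤ) : ZMod p) = s i := by
    intro i
    rw [ZMod.intCast_eq_intCast_iff]
    exact Int.mod_modEq _ _
  refine ⟨s' ∘ Tuple.sort s', ⟨?_, Tuple.monotone_sort s', ?_, ?_⟩, ?_⟩
  · unfold FactorsMod at *
    rw [hs]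
    simp only [Function.comp_apply, hcast]
    exact (Equiv.prod_comp (Tuple.sort s') fun i => (X - C (s i : ZMod p))).symm
  · intro i
    exact Int.emod_nonneg _ hp0.ne'
  · intro i
    exact Int.emod_lt_of_pos _ hp0
  · rintro r ⟨hr, hmono, h0, hlt⟩
    have hms : (Finset.univ.val.map fun i => (r i : ZMod p)) =
        Finset.univ.val.map fun i => (s i : ZMod p) := by
      have h : (∏ i, (X - C (r i : ZMod p))) = ∏ i, (X - C (s i : ZMod p)) := hr.symm.trans hs
      have h1 := congrArg Polynomial.roots h
      rw [Polynomial.roots_prod _ _ (Finset.prod_ne_zero_iff.2 fun i _ => X_sub_C_ne_zero _),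
        Polynomial.roots_prod _ _ (Finset.prod_ne_zero_iff.2 fun i _ => X_sub_C_ne_zero _)] at h1
      simp only [roots_X_sub_C, Multiset.bind_singleton] at h1
      exact h1
    have hval : ∀ a : ℤ, 0 ≤ a → a < p → (((a : ZMod p).val : ℕ) : ℤ) = a := by
      intro a ha hb
      rw [ZMod.val_intCast, Int.emod_eq_of_lt ha hb]
    have hms2 : (Finset.univ.val.map r) = Finset.univ.val.map s' := by
      have h2 := congrArg (Multiset.map fun z : ZMod p => ((z.val : ℕ) : ℤ)) hms
      rw [Multiset.map_map, Multiset.map_map] at h2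
      convert h2 using 2
      · rename_i i _
        exact (hval _ (h0 i) (hlt i)).symm
      · rename_i i _
        simp only [Function.comp_apply, ← hcast i]
        exact (hval _ (Int.emod_nonneg _ hp0.ne') (Int.emod_lt_of_pos _ hp0)).symm
    have hms3 : (Finset.univ.val.map r) = Finset.univ.val.map (s' ∘ Tuple.sort s') := by
      rw [hms2]
      have := Finset.univ.val.map_map s' (Tuple.sort s')
      rw [← this]
      congr 1
      have h4 := congrArg Finset.val (Finset.map_univ_equiv (Tuple.sort s'))
      simp
    have hperm : (List.ofFn r).Perm (List.ofFn (s' ∘ Tuple.sort s')) := by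
      rw [← Multiset.coe_eq_coe]
      rw [← Fin.univ_val_map, ← Fin.univ_val_map]
      exact hms3
    have heq := hperm.eq_of_sortedLE hmono.sortedLE_ofFn (Tuple.monotone_sort s').sortedLE_ofFn
    exact List.ofFn_injective heq

open Classical in
/-- The local roots `r₁ ≤ ⋯ ≤ rₙ` of `f` modulo `p` (and `0` if `f` does not split modulo `p`). -/
noncomputable def localRoots (n : ℕ) (f : ℤ[X]) (p : ℕ) : Fin n → ℤ :=
  if h : ∃ r : Fin n → ℤ, IsLocalRoots f p r then h.choose else 0

/-- The point `(r₁/p, …, rₙ/p)`. -/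
noncomputable def rootPoint (n : ℕ) (f : ℤ[X]) (p : ℕ) : EuclideanSpace ℝ (Fin n) :=
  WithLp.toLp 2 fun i => (localRoots n f p i : ℝ) / p

open Classical in
/-- `Spl_X(f)`: the primes `p ≤ X` for which `f` is a product of `n` linear factors modulo `p`. -/
noncomputable def spl (n : ℕ) (f : ℤ[X]) (x : ℝ) : Finset ℕ :=
  {p ∈ Finset.Iic ⌊x⌋₊ | p.Prime ∧ ∃ r : Fin n → ℤ, FactorsMod f p r}

open Classical in
/-- `Spl_X(f, σ)`: the primes `p ∈ Spl_X(f)` with `∑ᵢ m_{j,i} r_{σ(i)} ≡ m_j mod p` for all `j`. -/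
noncomputable def splPerm {n t : ℕ} (f : ℤ[X]) (m : Fin t → (Fin n → ℤ) × ℤ)
    (σ : Equiv.Perm (Fin n)) (x : ℝ) : Finset ℕ :=
  {p ∈ spl n f x | ∀ j, (∑ i, (m j).1 i * localRoots n f p (σ i)) ≡ (m j).2 [ZMOD p]}

/-- The quotient `#Spl_X(f, σ) / #Spl_X(f)`. -/
noncomputable def prRatio {n t : ℕ} (f : ℤ[X]) (m : Fin t → (Fin n → ℤ) × ℤ)
    (σ : Equiv.Perm (Fin n)) (x : ℝ) : ℝ :=
  ((splPerm f m σ x).card : ℝ) / ((spl n f x).card : ℝ)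

/-- The density `Pr(f, σ)`, the limit of `#Spl_X(f, σ) / #Spl_X(f)` as `X → ∞`. -/
noncomputable def pr {n t : ℕ} (f : ℤ[X]) (m : Fin t → (Fin n → ℤ) × ℤ)
    (σ : Equiv.Perm (Fin n)) : ℝ :=
  limUnder atTop (prRatio f m σ)

/-! ### The geometric side -/

/-- The set `𝔇(f, σ)` of the points `0 ≤ x₁ ≤ ⋯ ≤ xₙ ≤ 1` such that `∑ᵢ m_{j,i} x_{σ(i)}` is an
integer for all `j`. -/
def domain {n t : ℕ} (m : Fin t → (Fin n → ℤ) × ℤ) (σ : Equiv.Perm (Fin n)) :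
    Set (EuclideanSpace ℝ (Fin n)) :=
  {x | (∀ i, x i ∈ Set.Icc (0 : ℝ) 1) ∧ (∀ i j, i ≤ j → x i ≤ x j) ∧
    ∀ j, ∃ k : ℤ, ∑ i, ((m j).1 i : ℝ) * x (σ i) = k}

/-- The `d`-dimensional volume of a subset of Euclidean space: the Hausdorff measure normalized to
be Lebesgue measure on `d`-dimensional affine subspaces (through orthonormal coordinates). -/
noncomputable def vol {n : ℕ} (d : ℕ) (S : Set (EuclideanSpace ℝ (Fin n))) : ℝ :=
  (μHE[d] S).toReal

/-! ### The two conjectures, for a given polynomial -/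

/-- The first conjecture for `f`: the quotient `vol(𝔇(f, σ)) / Pr(f, σ)` is the same for all `σ`
with `Pr(f, σ) > 0`, and if `G = Ĝ`, then `Pr(f, σ) > 0` is equivalent to `vol(𝔇(f, σ)) > 0`. -/
def Conjecture1 {n t : ℕ} (f : ℤ[X]) (m : Fin t → (Fin n → ℤ) × ℤ) : Prop :=
  (∃ c : ℝ, ∀ σ, 0 < pr f m σ → vol (n - t) (domain m σ) / pr f m σ = c) ∧
  (group m = groupHat m → ∀ σ, 0 < pr f m σ ↔ 0 < vol (n - t) (domain m σ))

open Classical in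
/-- The second conjecture for `f`: if `n > 1` and `Pr(f, σ) > 0`, then the points `(r₁/p, …, rₙ/p)`
with `p ∈ Spl(f, σ)` are equidistributed in `𝔇(f, σ)`, tested on the sets `D ⊆ [0,1)ⁿ` that are
the closure of their interior. As in every statement of equidistribution, the test sets are those
whose boundary is a null set for the limit measure. -/
def Conjecture2 {n t : ℕ} (f : ℤ[X]) (m : Fin t → (Fin n → ℤ) × ℤ) : Prop :=
  1 < n → ∀ σ, 0 < pr f m σ → ∀ D : Set (EuclideanSpace ℝ (Fin n)),
    D = closure (interior D) → (∀ x ∈ D, ∀ i, x i ∈ Set.Ico (0 : ℝ) 1) →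
    vol (n - t) (frontier D ∩ domain m σ) = 0 →
    Tendsto (fun x : ℝ => (({p ∈ splPerm f m σ x | rootPoint n f p ∈ D}.card : ℝ)) /
        ((splPerm f m σ x).card : ℝ)) atTop
      (𝓝 (vol (n - t) (D ∩ domain m σ) / vol (n - t) (domain m σ)))

end LocalRoots

namespace LocalRoots

/-! ### The closed subgroup cut out by integral congruences -/

/-! Let `H` be the closed subgroup of `ℝⁿ` of all `x` with `m_j · x ∈ ℤ` for every `j`. It contains
`ℤⁿ`, and its `(n - t)`-dimensional measure, cut down to the unit cube, plays the role of Haar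
measure on the compact group `H/ℤⁿ`. An integral linear form that is nonzero on the identity
component of `H` has a translation-invariant image on the circle, hence is uniform modulo one
(`map_pairing_subgroupMeasure`). Irrationality of `αᵢ` makes this apply to the coordinate `xᵢ`;
irrationality of `αᵢ - αⱼ` makes the walls `xᵢ = xⱼ` null (`IsRelationBasis.isGeneric`).

Permuting coordinates by `σ` carries `𝔇(f, σ)` to the part of `H ∩ [0,1]ⁿ` ordered by `σ`. These
parts tile `H ∩ [0,1]ⁿ` up to null sets, so averaging over all `σ` and all coordinates gives the
uniform law on `[0,1]` (`IsGeneric.sum_vol_slabBox_inter_domain`).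

On the arithmetic side, every large `p` in `Spl(f)` lies in the same number `s` of sets `Spl(f, σ)`
(`exists_card_perm_eq`), so sums over `σ` count each such prime `s` times. Conjecture 1 makes `Pr(f,
σ)` proportional to the volume of `𝔇(f, σ)`, and Conjecture 2 distributes the points inside it;
summing over `σ` transfers the uniform law to the local roots (`tendsto_card_slabBox`). The test
sets of Conjecture 2 are closed inside `[0,1)ⁿ`, which yields only lower bounds for intervals; upper
bounds come from the complement. -/

/-- The linear form `x ↦ ∑ cᵢ xᵢ` with integral coefficients. -/
noncomputable def pairing {n : ℕ} (c : Fin n → ℤ) : EuclideanSpace ℝ (Fin n) →ₗ[ℝ] ℝ where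
  toFun x := ∑ i, (c i : ℝ) * x i
  map_add' x y := by simp [mul_add, Finset.sum_add_distrib]
  map_smul' r x := by
    simp only [PiLp.smul_apply, smul_eq_mul, RingHom.id_apply, Finset.mul_sum]
    exact Finset.sum_congr rfl fun i _ => by ring

theorem pairing_apply {n : ℕ} (c : Fin n → ℤ) (x : EuclideanSpace ℝ (Fin n)) :
    pairing c x = ∑ i, (c i : ℝ) * x i := rfl

theorem continuous_pairing {n : ℕ} (c : Fin n → ℤ) : Continuous (pairing c) :=
  (pairing c).continuous_of_finiteDimensional

/-- The closed subgroup of the `x` with `∑ᵢ A_{j,i} xᵢ ∈ ℤ` for all `j`. -/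
def integralSubgroup {n t : ℕ} (A : Fin t → Fin n → ℤ) : AddSubgroup (EuclideanSpace ℝ (Fin n)) where
  carrier := {x | ∀ j, ∃ k : ℤ, pairing (A j) x = k}
  zero_mem' j := ⟨0, by simp⟩
  add_mem' {x y} hx hy j := by
    obtain ⟨k, hk⟩ := hx j
    obtain ⟨l, hl⟩ := hy j
    exact ⟨k + l, by simp [hk, hl]⟩
  neg_mem' {x} hx j := by
    obtain ⟨k, hk⟩ := hx j
    exact ⟨-k, by simp [hk]⟩

theorem mem_integralSubgroup {n t : ℕ} {A : Fin t → Fin n → ℤ} {x : EuclideanSpace ℝ (Fin n)} :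
    x ∈ integralSubgroup A ↔ ∀ j, ∃ k : ℤ, pairing (A j) x = k := Iff.rfl

theorem isClosed_integralSubgroup {n t : ℕ} (A : Fin t → Fin n → ℤ) :
    IsClosed (integralSubgroup A : Set (EuclideanSpace ℝ (Fin n))) := by
  have : (integralSubgroup A : Set (EuclideanSpace ℝ (Fin n))) =
      ⋂ j, pairing (A j) ⁻¹' Set.range ((↑) : ℤ → ℝ) := by
    ext x
    simp [mem_integralSubgroup, eq_comm]
  rw [this]
  exact isClosed_iInter fun j =>
    Int.isClosedEmbedding_coe_real.isClosed_range.preimage (continuous_pairing _)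

theorem measurableSet_integralSubgroup {n t : ℕ} (A : Fin t → Fin n → ℤ) :
    MeasurableSet (integralSubgroup A : Set (EuclideanSpace ℝ (Fin n))) :=
  (isClosed_integralSubgroup A).measurableSet

/-- The standard basis of Euclidean space. -/
noncomputable abbrev stdBasis (n : ℕ) : Module.Basis (Fin n) ℝ (EuclideanSpace ℝ (Fin n)) :=
  (EuclideanSpace.basisFun (Fin n) ℝ).toBasis

/-- The lattice `ℤⁿ`. -/
noncomputable abbrev stdLattice (n : ℕ) : Submodule ℤ (EuclideanSpace ℝ (Fin n)) :=
  Submodule.span ℤ (Set.range (stdBasis n))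

/-- The half-open unit cube `[0,1)ⁿ`. -/
noncomputable abbrev unitCube (n : ℕ) : Set (EuclideanSpace ℝ (Fin n)) :=
  ZSpan.fundamentalDomain (stdBasis n)

theorem mem_unitCube {n : ℕ} {x : EuclideanSpace ℝ (Fin n)} :
    x ∈ unitCube n ↔ ∀ i, x i ∈ Set.Ico (0 : ℝ) 1 := by
  simp [unitCube, ZSpan.mem_fundamentalDomain]

theorem measurableSet_unitCube (n : ℕ) : MeasurableSet (unitCube n) :=
  ZSpan.fundamentalDomain_measurableSet _

theorem pairing_mem_int_of_mem_stdLattice {n : ℕ} (c : Fin n → ℤ) {x : EuclideanSpace ℝ (Fin n)}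
    (hx : x ∈ stdLattice n) : ∃ k : ℤ, pairing c x = k := by
  induction hx using Submodule.span_induction with
  | mem x hx =>
    obtain ⟨i, rfl⟩ := hx
    refine ⟨c i, ?_⟩
    simp [pairing_apply]
  | zero => exact ⟨0, by simp⟩
  | add x y _ _ hx hy =>
    obtain ⟨k, hk⟩ := hx
    obtain ⟨l, hl⟩ := hy
    exact ⟨k + l, by simp [hk, hl]⟩
  | smul a x _ hx =>
    obtain ⟨k, hk⟩ := hx
    exact ⟨a * k, by rw [map_zsmul, hk]; simp⟩

theorem stdLattice_le {n t : ℕ} (A : Fin t → Fin n → ℤ) {x : EuclideanSpace ℝ (Fin n)}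
    (hx : x ∈ stdLattice n) : x ∈ integralSubgroup A :=
  fun j => pairing_mem_int_of_mem_stdLattice (A j) hx

/-- The `d`-dimensional measure on the closed subgroup `integralSubgroup A`. -/
noncomputable def subgroupMeasure {n t : ℕ} (d : ℕ) (A : Fin t → Fin n → ℤ) :
    Measure (EuclideanSpace ℝ (Fin n)) :=
  (μHE[d]).restrict (integralSubgroup A)

theorem subgroupMeasure_apply {n t d : ℕ} (A : Fin t → Fin n → ℤ)
    (B : Set (EuclideanSpace ℝ (Fin n))) :
    subgroupMeasure d A B = μHE[d] (B ∩ integralSubgroup A) :=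
  Measure.restrict_apply' (measurableSet_integralSubgroup A)

theorem subgroupMeasure_preimage_add {n t d : ℕ} (A : Fin t → Fin n → ℤ)
    {v : EuclideanSpace ℝ (Fin n)} (hv : v ∈ integralSubgroup A)
    (B : Set (EuclideanSpace ℝ (Fin n))) :
    subgroupMeasure d A ((fun x => v + x) ⁻¹' B) = subgroupMeasure d A B := by
  rw [subgroupMeasure_apply, subgroupMeasure_apply]
  have h : (fun x => v + x) ⁻¹' B ∩ integralSubgroup A =
      (fun x => v + x) ⁻¹' (B ∩ integralSubgroup A) := by
    ext x
    simp only [Set.mem_inter_iff, Set.mem_preimage, SetLike.mem_coe]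
    rw [AddSubgroup.add_mem_cancel_left _ hv]
  rw [h, measure_preimage_add]

instance vaddInvariantMeasure_subgroupMeasure {n t d : ℕ} (A : Fin t → Fin n → ℤ) :
    VAddInvariantMeasure (stdLattice n) (EuclideanSpace ℝ (Fin n)) (subgroupMeasure d A) where
  measure_preimage_vadd g B _ := subgroupMeasure_preimage_add A (stdLattice_le A g.2) B

/-- The part of an `ℤⁿ`-invariant set in the unit cube keeps its measure when the set is
translated by an element of the subgroup. -/
theorem subgroupMeasure_shift_inter_unitCube {n t d : ℕ} (A : Fin t → Fin n → ℤ)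
    {v : EuclideanSpace ℝ (Fin n)} (hv : v ∈ integralSubgroup A)
    {B : Set (EuclideanSpace ℝ (Fin n))} (hB : MeasurableSet B)
    (hinv : ∀ g ∈ stdLattice n, (fun x => g + x) ⁻¹' B = B) :
    subgroupMeasure d A ((fun x => v + x) ⁻¹' B ∩ unitCube n) =
      subgroupMeasure d A (B ∩ unitCube n) := by
  have h1 := ZSpan.isAddFundamentalDomain (stdBasis n) (subgroupMeasure d A)
  -- A translate of the unit cube is again a fundamental domain for `ℤⁿ`, and an invariant set has
  -- the same measure in any two fundamental domains.
  have h2 : IsAddFundamentalDomain (stdLattice n) ((fun x => -v + x) ⁻¹' unitCube n)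
      (subgroupMeasure d A) := by
    refine IsAddFundamentalDomain.mk'
      ((measurableSet_unitCube n).preimage (measurable_const_add _)).nullMeasurableSet fun x => ?_
    obtain ⟨g, hg, hu⟩ := ZSpan.exist_unique_vadd_mem_fundamentalDomain (stdBasis n) (-v + x)
    have key : ∀ g : stdLattice n, (-v + (g +ᵥ x)) = g +ᵥ (-v + x) := fun g => by
      simp only [Submodule.vadd_def, vadd_eq_add]; abel
    refine ⟨g, ?_, fun g' hg' => hu g' ?_⟩
    · simpa only [Set.mem_preimage, key] using hg
    · simpa only [Set.mem_preimage, key] using hg'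
  rw [h1.measure_set_eq h2 hB fun g => hinv g g.2, ← subgroupMeasure_preimage_add A hv (B ∩ _)]
  congr 1
  ext x
  simp

/-! ### Uniform distribution modulo one on the subgroup -/

/-- A linear form that does not vanish on the identity component of the subgroup is uniformly
distributed modulo one. -/
theorem map_pairing_subgroupMeasure {n t d : ℕ} (A : Fin t → Fin n → ℤ)
    (hfin : subgroupMeasure d A (unitCube n) ≠ ⊤) (c : Fin n → ℤ)
    {v : EuclideanSpace ℝ (Fin n)} (hv : ∀ j, pairing (A j) v = 0) (hc : pairing c v ≠ 0) :
    ((subgroupMeasure d A).restrict (unitCube n)).map (fun x => (pairing c x : UnitAddCircle)) =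
      (subgroupMeasure d A (unitCube n)) • (volume : Measure UnitAddCircle) := by
  have hmeas : Measurable fun x => (pairing c x : UnitAddCircle) :=
    ((AddCircle.continuous_mk' 1).comp (continuous_pairing c)).measurable
  set ν := ((subgroupMeasure d A).restrict (unitCube n)).map
    (fun x => (pairing c x : UnitAddCircle)) with hν
  have happ : ∀ U : Set UnitAddCircle, MeasurableSet U →
      ν U = subgroupMeasure d A ((fun x => (pairing c x : UnitAddCircle)) ⁻¹' U ∩ unitCube n) := by
    intro U hU
    rw [hν, Measure.map_apply hmeas hU, Measure.restrict_apply (hmeas hU)]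
  have huniv : ν Set.univ = subgroupMeasure d A (unitCube n) := by
    rw [happ _ MeasurableSet.univ]; simp
  have : IsFiniteMeasure ν := ⟨by rw [huniv]; exact hfin.lt_top⟩
  have : ν.IsAddLeftInvariant := by
    refine ⟨fun g => ?_⟩
    obtain ⟨s, rfl⟩ := QuotientAddGroup.mk_surjective g
    ext U hU
    rw [Measure.map_apply (measurable_const_add _) hU, happ _ hU,
      happ _ (hU.preimage (measurable_const_add _))]
    -- Rotation of the circle by `s` lifts to translation by the multiple of `v` on which the form
    -- takes the value `s`; this multiple stays in the subgroup.
    have hw : (s / pairing c v) • v ∈ integralSubgroup A := fun j => ⟨0, by simp [hv j]⟩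
    rw [← subgroupMeasure_shift_inter_unitCube A hw (hmeas hU)]
    · congr 2
      ext x
      have : s / pairing c v * pairing c v = s := by field_simp
      simp only [Set.mem_preimage, map_add, map_smul, smul_eq_mul, this]
      rfl
    · intro g hg
      obtain ⟨k, hk⟩ := pairing_mem_int_of_mem_stdLattice c hg
      ext x
      have : ((k : ℝ) : UnitAddCircle) = 0 := by
        rw [AddCircle.coe_eq_zero_iff]; exact ⟨k, by simp⟩
      simp [hk, this]
  obtain ⟨s, hs⟩ : ∃ s : NNReal, ν = s • (volume : Measure UnitAddCircle) :=
    ⟨_, Measure.isAddInvariant_eq_smul_of_compactSpace ν volume⟩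
  rw [hs, Measure.smul_apply, UnitAddCircle.measure_univ] at huniv
  rw [hs, ← huniv]
  clear_value ν
  ext U hU
  simp only [Measure.smul_apply, ENNReal.smul_def, smul_eq_mul, mul_one]

theorem unitAddCircle_eq_of_abs_sub_lt {y z : ℝ} (h : (y : UnitAddCircle) = z)
    (hlt : |y - z| < 1) : y = z := by
  have h1 : ((y - z : ℝ) : UnitAddCircle) = 0 := by
    rw [AddCircle.coe_sub, h, sub_self]
  obtain ⟨k, hk⟩ := (AddCircle.coe_eq_zero_iff 1).1 h1
  have hk' : (k : ℝ) = y - z := by simpa using hk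
  rw [← hk'] at hlt
  have : k = 0 := Int.abs_lt_one_iff.1 (by exact_mod_cast hlt)
  rw [this] at hk'
  simp at hk'
  linarith

theorem isClosed_image_Icc_unitAddCircle (u w : ℝ) :
    IsClosed ((fun y : ℝ => (y : UnitAddCircle)) '' Set.Icc u w) :=
  (isCompact_Icc.image (AddCircle.continuous_mk' 1)).isClosed

theorem volume_image_Icc_unitAddCircle {u w : ℝ} (h : w < u + 1) :
    volume ((fun y : ℝ => (y : UnitAddCircle)) '' Set.Icc u w) = ENNReal.ofReal (w - u) := by
  rw [← (UnitAddCircle.measurePreserving_mk (w - 1)).measure_preimage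
    (isClosed_image_Icc_unitAddCircle u w).measurableSet.nullMeasurableSet,
    Measure.restrict_apply' measurableSet_Ioc, ← Real.volume_Icc]
  congr 1
  ext y
  constructor
  · rintro ⟨⟨z, hz, hzy⟩, hy⟩
    have : z = y := unitAddCircle_eq_of_abs_sub_lt hzy (by
      rw [abs_lt]; constructor <;> linarith [hz.1, hz.2, hy.1, hy.2])
    exact this ▸ hz
  · intro hy
    exact ⟨⟨y, hy, rfl⟩, by linarith [hy.1], by linarith [hy.2]⟩

/-- The measure of a slab of the subgroup in the unit cube. -/
theorem subgroupMeasure_slab {n t d : ℕ} (A : Fin t → Fin n → ℤ)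
    (hfin : subgroupMeasure d A (unitCube n) ≠ ⊤) (i : Fin n)
    (hi : ∃ v, (∀ j, pairing (A j) v = 0) ∧ v i ≠ 0) {u w : ℝ} (hu : 0 ≤ u) (hw : w < 1) :
    subgroupMeasure d A ({x | x i ∈ Set.Icc u w} ∩ unitCube n) =
      ENNReal.ofReal (w - u) * subgroupMeasure d A (unitCube n) := by
  obtain ⟨v, hv, hvi⟩ := hi
  have hp : ∀ x : EuclideanSpace ℝ (Fin n), pairing (Pi.single i 1) x = x i := by
    intro x
    simp [pairing_apply, Pi.single_apply]
  have hmeas : Measurable fun x => (pairing (Pi.single i 1 : Fin n → ℤ) x : UnitAddCircle) :=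
    ((AddCircle.continuous_mk' 1).comp (continuous_pairing _)).measurable
  have hU := (isClosed_image_Icc_unitAddCircle u w).measurableSet
  have h := congrArg (fun μ : Measure UnitAddCircle =>
      μ ((fun y : ℝ => (y : UnitAddCircle)) '' Set.Icc u w))
    (map_pairing_subgroupMeasure A hfin (Pi.single i 1) hv (by rwa [hp]))
  simp only [Measure.smul_apply, smul_eq_mul] at h
  rw [Measure.map_apply hmeas hU, Measure.restrict_apply (hmeas hU),
    volume_image_Icc_unitAddCircle (by linarith), mul_comm] at h
  rw [← h]
  congr 1
  ext x
  simp only [Set.mem_inter_iff, Set.mem_ofPred_eq, Set.mem_preimage, hp]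
  -- Both `x i` and the points of `[u, w]` lie in `[0,1)`, so congruence modulo one is equality.
  refine and_congr_left fun hx => ⟨fun hxi => ⟨x i, hxi, rfl⟩, ?_⟩
  rintro ⟨z, hz, hzx⟩
  have hxi := mem_unitCube.1 hx i
  have : z = x i := unitAddCircle_eq_of_abs_sub_lt hzx (by
    rw [abs_lt]; constructor <;> linarith [hz.1, hz.2, hxi.1, hxi.2])
  exact this ▸ hz

/-- A slice of the subgroup by a linear form that does not vanish on its identity component is
a null set. -/
theorem subgroupMeasure_slice {n t d : ℕ} (A : Fin t → Fin n → ℤ)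
    (hfin : subgroupMeasure d A (unitCube n) ≠ ⊤) (c : Fin n → ℤ)
    (hc : ∃ v, (∀ j, pairing (A j) v = 0) ∧ pairing c v ≠ 0) (s : ℝ) :
    subgroupMeasure d A {x | pairing c x = s} = 0 := by
  obtain ⟨v, hv, hcv⟩ := hc
  have hmeas : Measurable fun x => (pairing c x : UnitAddCircle) :=
    ((AddCircle.continuous_mk' 1).comp (continuous_pairing c)).measurable
  have hU := (isClosed_image_Icc_unitAddCircle s s).measurableSet
  have h := congrArg (fun μ : Measure UnitAddCircle =>
      μ ((fun y : ℝ => (y : UnitAddCircle)) '' Set.Icc s s))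
    (map_pairing_subgroupMeasure A hfin c hv hcv)
  simp only [Measure.smul_apply, smul_eq_mul] at h
  rw [Measure.map_apply hmeas hU, Measure.restrict_apply (hmeas hU),
    volume_image_Icc_unitAddCircle (by linarith)] at h
  simp only [Set.Icc_self, Set.image_singleton, sub_self, ENNReal.ofReal_zero, mul_zero] at h
  -- The preimage of one point of the circle is `ℤⁿ`-invariant, so being null in the unit cube makes
  -- it null everywhere.
  have h0 : subgroupMeasure d A ((fun x => (pairing c x : UnitAddCircle)) ⁻¹' {(s : UnitAddCircle)})
      = 0 := by
    refine (ZSpan.isAddFundamentalDomain (stdBasis n)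
      (subgroupMeasure d A)).measure_zero_of_invariant _ (fun g => ?_) h
    obtain ⟨k, hk⟩ := pairing_mem_int_of_mem_stdLattice c (-g).2
    have hk0 : ((k : ℝ) : UnitAddCircle) = 0 := by
      rw [AddCircle.coe_eq_zero_iff]; exact ⟨k, by simp⟩
    ext x
    rw [Set.mem_vadd_set_iff_neg_vadd_mem]
    simp only [Set.mem_preimage, Submodule.vadd_def, vadd_eq_add, map_add, hk, AddCircle.coe_add,
      hk0, zero_add]
  refine measure_mono_null (fun x hx => ?_) h0
  simp only [Set.mem_preimage, Set.mem_singleton_iff]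
  rw [show pairing c x = s from hx]

/-! ### Dimension, finiteness and positivity of the measure -/

/-- The identity component of `integralSubgroup A`. -/
noncomputable def kernelSubspace {n t : ℕ} (A : Fin t → Fin n → ℤ) :
    Submodule ℝ (EuclideanSpace ℝ (Fin n)) :=
  LinearMap.ker (LinearMap.pi fun j => pairing (A j))

theorem mem_kernelSubspace {n t : ℕ} {A : Fin t → Fin n → ℤ} {x : EuclideanSpace ℝ (Fin n)} :
    x ∈ kernelSubspace A ↔ ∀ j, pairing (A j) x = 0 := by
  simp [kernelSubspace, funext_iff]

/-- Independence over `ℤ` persists over `ℝ`, so the matrix has rank `t`. This is what makes `n - t`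
the right dimension for the measure. -/
theorem finrank_kernelSubspace {n t : ℕ} {A : Fin t → Fin n → ℤ} (hA : LinearIndependent ℤ A) :
    Module.finrank ℝ (kernelSubspace A) = n - t := by
  have hR' : LinearIndependent ℝ (fun j => algebraMap ℤ ℝ ∘ A j) :=
    linearIndependent_algebraMap_comp_iff.2 hA
  have hR : LinearIndependent ℝ (Matrix.of fun j i => (A j i : ℝ)).row := by
    convert hR' using 1
    rfl
  have hrank := hR.rank_matrix
  have heq : (LinearMap.pi fun j => pairing (A j)) =
      (Matrix.of fun j i => (A j i : ℝ)).mulVecLin ∘ₗ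
        (WithLp.linearEquiv 2 ℝ (Fin n → ℝ)).toLinearMap := by
    ext x j
    simp [pairing_apply, Matrix.mulVec, dotProduct]
  have h := LinearMap.finrank_range_add_finrank_ker (LinearMap.pi fun j => pairing (A j))
  rw [finrank_euclideanSpace_fin] at h
  have h2 : Module.finrank ℝ (LinearMap.range (LinearMap.pi fun j => pairing (A j))) = t := by
    rw [heq, LinearMap.range_comp_of_range_eq_top _ (LinearEquiv.range _)]
    rw [Matrix.rank] at hrank
    simpa using hrank
  have h3 : Module.finrank ℝ (kernelSubspace A) =
    Module.finrank ℝ (LinearMap.ker (LinearMap.pi fun j => pairing (A j))) := rfl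
  omega

theorem euclideanHausdorffMeasure_ball_ne_top {E : Type*} [NormedAddCommGroup E]
    [InnerProductSpace ℝ E] [FiniteDimensional ℝ E] [MeasurableSpace E] [BorelSpace E]
    (V : Submodule ℝ E) (r : ℝ) :
    μHE[Module.finrank ℝ V] {x : E | x ∈ V ∧ ‖x‖ ≤ r} ≠ ⊤ := by
  have h : {x : E | x ∈ V ∧ ‖x‖ ≤ r} = Subtype.val '' (Metric.closedBall (0 : V) r) := by
    ext x
    simp [and_comm]
  rw [h, isometry_subtype_coe.euclideanHausdorffMeasure_image]
  exact (isCompact_closedBall (0 : V) r).measure_ne_top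

theorem euclideanHausdorffMeasure_submodule_ne_zero {E : Type*} [NormedAddCommGroup E]
    [InnerProductSpace ℝ E] [FiniteDimensional ℝ E] [MeasurableSpace E] [BorelSpace E]
    (V : Submodule ℝ E) : μHE[Module.finrank ℝ V] (V : Set E) ≠ 0 := by
  have h : (V : Set E) = Subtype.val '' (Set.univ : Set V) := by simp
  rw [h, isometry_subtype_coe.euclideanHausdorffMeasure_image]
  exact isOpen_univ.measure_ne_zero _ Set.univ_nonempty

theorem norm_le_of_mem_Icc {n : ℕ} {x : EuclideanSpace ℝ (Fin n)}
    (hx : ∀ i, x i ∈ Set.Icc (0 : ℝ) 1) : ‖x‖ ≤ Real.sqrt n := by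
  rw [EuclideanSpace.norm_eq]
  refine Real.sqrt_le_sqrt ?_
  calc ∑ i, ‖x i‖ ^ 2 ≤ ∑ i : Fin n, (1 : ℝ) := Finset.sum_le_sum fun i _ => by
        rw [Real.norm_eq_abs, sq_abs]
        nlinarith [(hx i).1, (hx i).2]
    _ = n := by simp

theorem abs_pairing_le {n : ℕ} (c : Fin n → ℤ) {x : EuclideanSpace ℝ (Fin n)}
    (hx : ∀ i, x i ∈ Set.Icc (0 : ℝ) 1) : |pairing c x| ≤ (∑ i, |c i| : ℤ) := by
  rw [pairing_apply]
  push_cast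
  refine (Finset.abs_sum_le_sum_abs _ _).trans (Finset.sum_le_sum fun i _ => ?_)
  rw [abs_mul, abs_of_nonneg (hx i).1]
  exact mul_le_of_le_one_right (abs_nonneg _) (hx i).2

/-- On the cube each pairing is bounded by `∑ |A j i|`, so it takes finitely many integral values.
Each resulting fibre lies in a translate of a bounded piece of the kernel subspace. -/
theorem subgroupMeasure_closedCube_ne_top {n t : ℕ} {A : Fin t → Fin n → ℤ}
    (hA : LinearIndependent ℤ A) :
    subgroupMeasure (n - t) A {x | ∀ i, x i ∈ Set.Icc (0 : ℝ) 1} ≠ ⊤ := by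
  rw [subgroupMeasure_apply]
  set K : Set (Fin t → ℤ) := Set.pi Set.univ fun j => Set.Icc (-∑ i, |A j i|) (∑ i, |A j i|)
  have hK : K.Finite := Set.Finite.pi fun j => Set.finite_Icc _ _
  set F : (Fin t → ℤ) → Set (EuclideanSpace ℝ (Fin n)) := fun k =>
    {x | (∀ i, x i ∈ Set.Icc (0 : ℝ) 1) ∧ ∀ j, pairing (A j) x = k j}
  have hsub : {x : EuclideanSpace ℝ (Fin n) | ∀ i, x i ∈ Set.Icc (0 : ℝ) 1} ∩
      integralSubgroup A ⊆ ⋃ k ∈ K, F k := by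
    rintro x ⟨hx, hxA⟩
    choose k hk using hxA
    refine Set.mem_biUnion (x := k) (fun j _ => ?_) ⟨hx, hk⟩
    have := abs_pairing_le (A j) hx
    rw [hk] at this
    exact abs_le.1 (by exact_mod_cast this)
  refine ne_top_of_le_ne_top ?_ (measure_mono hsub)
  refine (measure_biUnion_lt_top hK fun k _ => ?_).ne
  rcases (F k).eq_empty_or_nonempty with h | ⟨x₀, hx₀⟩
  · simp [h]
  · have hFk : F k ⊆ (fun x => -x₀ + x) ⁻¹'
        {x | x ∈ kernelSubspace A ∧ ‖x‖ ≤ Real.sqrt n + Real.sqrt n} := by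
      intro x hx
      refine ⟨mem_kernelSubspace.2 fun j => by simp [hx.2 j, hx₀.2 j], ?_⟩
      refine (norm_add_le _ _).trans ?_
      rw [norm_neg]
      exact add_le_add (norm_le_of_mem_Icc hx₀.1) (norm_le_of_mem_Icc hx.1)
    refine (measure_mono hFk).trans_lt ?_
    rw [measure_preimage_add, ← finrank_kernelSubspace hA]
    exact (euclideanHausdorffMeasure_ball_ne_top _ _).lt_top

theorem subgroupMeasure_unitCube_ne_top {n t : ℕ} {A : Fin t → Fin n → ℤ}
    (hA : LinearIndependent ℤ A) : subgroupMeasure (n - t) A (unitCube n) ≠ ⊤ :=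
  ne_top_of_le_ne_top (subgroupMeasure_closedCube_ne_top hA) <|
    measure_mono fun _ hx i => Set.Ico_subset_Icc_self (mem_unitCube.1 hx i)

/-- If the unit cube were null, invariance would make the whole subgroup null, although it contains
a subspace of dimension `n - t`. -/
theorem subgroupMeasure_unitCube_ne_zero {n t : ℕ} {A : Fin t → Fin n → ℤ}
    (hA : LinearIndependent ℤ A) : subgroupMeasure (n - t) A (unitCube n) ≠ 0 := by
  intro h0
  have h := (ZSpan.isAddFundamentalDomain (stdBasis n)
      (subgroupMeasure (n - t) A)).measure_zero_of_invariant Set.univ (fun g => Set.vadd_set_univ)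
      (by rwa [Set.univ_inter])
  rw [subgroupMeasure_apply, Set.univ_inter] at h
  refine euclideanHausdorffMeasure_submodule_ne_zero (kernelSubspace A) ?_
  rw [finrank_kernelSubspace hA]
  refine measure_mono_null (t := integralSubgroup A) (fun x hx => ?_) h
  exact mem_integralSubgroup.2 fun j => ⟨0, by simp [mem_kernelSubspace.1 hx j]⟩

/-! ### Boxes as test sets -/

/-- Boxes with sides parallel to the axes. -/
def box {n : ℕ} (lo hi : Fin n → ℝ) : Set (EuclideanSpace ℝ (Fin n)) :=
  {x | ∀ i, x i ∈ Set.Icc (lo i) (hi i)}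

theorem isClosed_box {n : ℕ} (lo hi : Fin n → ℝ) : IsClosed (box lo hi) := by
  have : box lo hi = ⋂ i, (fun x : EuclideanSpace ℝ (Fin n) => x i) ⁻¹' Set.Icc (lo i) (hi i) := by
    ext x; simp [box]
  rw [this]
  exact isClosed_iInter fun i => isClosed_Icc.preimage (by fun_prop)

theorem box_eq_preimage {n : ℕ} (lo hi : Fin n → ℝ) :
    box lo hi = (PiLp.homeomorph 2 fun _ : Fin n => ℝ) ⁻¹'
      Set.pi Set.univ fun i => Set.Icc (lo i) (hi i) := by
  ext x
  exact ⟨fun h i _ => h i, fun h i => h i trivial⟩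

theorem interior_box {n : ℕ} (lo hi : Fin n → ℝ) :
    interior (box lo hi) = {x | ∀ i, x i ∈ Set.Ioo (lo i) (hi i)} := by
  rw [box_eq_preimage, ← Homeomorph.preimage_interior, interior_pi_set Set.finite_univ]
  simp only [interior_Icc]
  ext x
  exact ⟨fun h i => h i trivial, fun h i _ => h i⟩

theorem closure_interior_box {n : ℕ} {lo hi : Fin n → ℝ} (h : ∀ i, lo i < hi i) :
    box lo hi = closure (interior (box lo hi)) := by
  rw [box_eq_preimage, ← Homeomorph.preimage_interior, ← Homeomorph.preimage_closure,
    interior_pi_set Set.finite_univ, closure_pi_set]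
  simp only [interior_Icc, closure_Ioo (h _).ne]

theorem frontier_box_subset {n : ℕ} (lo hi : Fin n → ℝ) :
    frontier (box lo hi) ⊆ ⋃ i, ({x | x i = lo i} ∪ {x | x i = hi i}) := by
  intro x hx
  rw [frontier, (isClosed_box lo hi).closure_eq, interior_box] at hx
  obtain ⟨h1, h2⟩ := hx
  simp only [Set.mem_ofPred_eq, not_forall] at h2
  obtain ⟨i, hi⟩ := h2
  refine Set.mem_iUnion.2 ⟨i, ?_⟩
  by_contra hcon
  simp only [Set.mem_union, Set.mem_ofPred_eq, not_or] at hcon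
  exact hi ⟨lt_of_le_of_ne (h1 i).1 (Ne.symm hcon.1), lt_of_le_of_ne (h1 i).2 hcon.2⟩

/-! ### Chambers of the cube -/

/-- The permutation of the coordinates of Euclidean space. -/
noncomputable def permCoord {n : ℕ} (σ : Equiv.Perm (Fin n)) :
    EuclideanSpace ℝ (Fin n) ≃ᵢ EuclideanSpace ℝ (Fin n) :=
  (LinearIsometryEquiv.piLpCongrLeft 2 ℝ ℝ σ).toIsometryEquiv

theorem permCoord_apply {n : ℕ} (σ : Equiv.Perm (Fin n)) (x : EuclideanSpace ℝ (Fin n))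
    (i : Fin n) : permCoord σ x i = x (σ.symm i) := by
  simp [permCoord, LinearIsometryEquiv.piLpCongrLeft_apply]

theorem permCoord_preimage_box {n : ℕ} (σ : Equiv.Perm (Fin n)) (lo hi : Fin n → ℝ) :
    permCoord σ ⁻¹' box lo hi = box (lo ∘ σ) (hi ∘ σ) := by
  ext x
  simp only [Set.mem_preimage, box, Set.mem_ofPred_eq, permCoord_apply, Function.comp_apply]
  rw [← σ.forall_congr_right]
  simp

theorem euclideanHausdorffMeasure_permCoord_preimage {n : ℕ} (d : ℕ) (σ : Equiv.Perm (Fin n))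
    (S : Set (EuclideanSpace ℝ (Fin n))) : μHE[d] (permCoord σ ⁻¹' S) = μHE[d] S := by
  rw [(permCoord σ).isometry.euclideanHausdorffMeasure_preimage]
  simp

/-- The closed unit cube `[0,1]ⁿ`. -/
abbrev closedCube (n : ℕ) : Set (EuclideanSpace ℝ (Fin n)) := box 0 1

/-- The points with integral pairings in the closed cube whose coordinates are ordered by `σ`. -/
def chamber {n t : ℕ} (A : Fin t → Fin n → ℤ) (σ : Equiv.Perm (Fin n)) :
    Set (EuclideanSpace ℝ (Fin n)) :=
  {x | x ∈ closedCube n ∧ x ∈ integralSubgroup A ∧ Monotone fun i => x (σ.symm i)}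

theorem isClosed_chamber {n t : ℕ} (A : Fin t → Fin n → ℤ) (σ : Equiv.Perm (Fin n)) :
    IsClosed (chamber A σ) := by
  have h : IsClosed {x : EuclideanSpace ℝ (Fin n) | Monotone fun i => x (σ.symm i)} := by
    have : {x : EuclideanSpace ℝ (Fin n) | Monotone fun i => x (σ.symm i)} =
        ⋂ i, ⋂ j, ⋂ (_ : i ≤ j), {x | x (σ.symm i) ≤ x (σ.symm j)} := by
      ext x; simp [Monotone]
    rw [this]
    exact isClosed_iInter fun i => isClosed_iInter fun j => isClosed_iInter fun _ =>
      isClosed_le (by fun_prop) (by fun_prop)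
  exact (isClosed_box _ _).inter ((isClosed_integralSubgroup A).inter h)

/-- Relabelling the coordinates moves `σ` from the congruences to the ordering, so that all the
domains become pieces of one and the same subgroup. -/
theorem permCoord_preimage_domain {n t : ℕ} (m : Fin t → (Fin n → ℤ) × ℤ)
    (σ : Equiv.Perm (Fin n)) :
    permCoord σ ⁻¹' domain m σ = chamber (fun j => (m j).1) σ := by
  ext x
  simp only [Set.mem_preimage, domain, Set.mem_ofPred_eq, chamber, closedCube, box,
    mem_integralSubgroup, pairing_apply, permCoord_apply, Equiv.symm_apply_apply, Pi.zero_apply,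
    Pi.one_apply]
  refine and_congr ?_ (and_comm.trans (and_congr Iff.rfl ?_))
  · rw [← σ.forall_congr_right]
    simp
  · exact ⟨fun h i j hij => h i j hij, fun h i j hij => h hij⟩

theorem euclideanHausdorffMeasure_inter_domain {n t : ℕ} (d : ℕ) (m : Fin t → (Fin n → ℤ) × ℤ)
    (σ : Equiv.Perm (Fin n)) (D : Set (EuclideanSpace ℝ (Fin n))) :
    μHE[d] (D ∩ domain m σ) =
      μHE[d] (permCoord σ ⁻¹' D ∩ chamber (fun j => (m j).1) σ) := by
  rw [← permCoord_preimage_domain, ← Set.preimage_inter,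
    euclideanHausdorffMeasure_permCoord_preimage]

theorem iUnion_chamber {n t : ℕ} (A : Fin t → Fin n → ℤ) :
    ⋃ σ, chamber A σ = closedCube n ∩ integralSubgroup A := by
  ext x
  simp only [Set.mem_iUnion, chamber, Set.mem_ofPred_eq, Set.mem_inter_iff, SetLike.mem_coe]
  constructor
  · rintro ⟨σ, h1, h2, -⟩
    exact ⟨h1, h2⟩
  · rintro ⟨h1, h2⟩
    exact ⟨(Tuple.sort fun i => x i).symm, h1, h2, Tuple.monotone_sort fun i => x i⟩

theorem eq_of_monotone_comp {n : ℕ} {x : Fin n → ℝ} (hx : Function.Injective x)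
    {σ τ : Equiv.Perm (Fin n)} (hσ : Monotone fun i => x (σ.symm i))
    (hτ : Monotone fun i => x (τ.symm i)) : σ = τ := by
  have h1 : StrictMono fun i => x (σ.symm i) :=
    hσ.strictMono_of_injective (hx.comp σ.symm.injective)
  have h2 : StrictMono fun i => x (τ.symm i) :=
    hτ.strictMono_of_injective (hx.comp τ.symm.injective)
  have h := (StrictMono.range_inj h1 h2).1 (by
    rw [← Function.comp_def x, ← Function.comp_def x, σ.symm.surjective.range_comp,
      τ.symm.surjective.range_comp])
  have h3 : σ.symm = τ.symm := Equiv.ext fun i => hx (congrFun h i)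
  simpa using congrArg Equiv.symm h3

/-! ### Generic subgroups -/

/-- The coordinates and their differences do not vanish on the identity component of
`integralSubgroup A`. -/
structure IsGeneric {n t : ℕ} (A : Fin t → Fin n → ℤ) : Prop where
  linearIndependent : LinearIndependent ℤ A
  coord : ∀ i, ∃ v, (∀ j, pairing (A j) v = 0) ∧ v i ≠ 0
  coord_sub : ∀ i i', i ≠ i' → ∃ v, (∀ j, pairing (A j) v = 0) ∧ v i ≠ v i'

section Generic

variable {n t : ℕ} {A : Fin t → Fin n → ℤ}

theorem IsGeneric.measure_coord_eq (h : IsGeneric A) (i : Fin n) (s : ℝ) :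
    subgroupMeasure (n - t) A {x | x i = s} = 0 := by
  have hp : ∀ x : EuclideanSpace ℝ (Fin n), pairing (Pi.single i 1) x = x i := by
    intro x
    simp [pairing_apply, Pi.single_apply]
  obtain ⟨v, hv, hvi⟩ := h.coord i
  have := subgroupMeasure_slice A (subgroupMeasure_unitCube_ne_top h.linearIndependent)
    (Pi.single i 1) ⟨v, hv, by rwa [hp]⟩ s
  simpa only [hp] using this

theorem IsGeneric.measure_coord_eq_coord (h : IsGeneric A) {i i' : Fin n} (hi : i ≠ i') :
    subgroupMeasure (n - t) A {x | x i = x i'} = 0 := by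
  have hp : ∀ x : EuclideanSpace ℝ (Fin n),
      pairing (Pi.single i 1 - Pi.single i' 1) x = x i - x i' := by
    intro x
    simp [pairing_apply, Pi.single_apply, sub_mul]
  obtain ⟨v, hv, hvi⟩ := h.coord_sub i i' hi
  have := subgroupMeasure_slice A (subgroupMeasure_unitCube_ne_top h.linearIndependent)
    (Pi.single i 1 - Pi.single i' 1) ⟨v, hv, by rw [hp]; exact sub_ne_zero.2 hvi⟩ 0
  simpa only [hp, sub_eq_zero] using this

/-- A point with distinct coordinates is sorted by only one permutation, so two chambers meet only
on the null walls `x i = x i'`. -/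
theorem IsGeneric.aedisjoint_chamber (h : IsGeneric A) :
    Pairwise (Function.onFun (AEDisjoint μHE[n - t]) (chamber A)) := by
  intro σ τ hστ
  have hnull : subgroupMeasure (n - t) A
      (⋃ i, ⋃ i', ⋃ (_ : i ≠ i'), {x : EuclideanSpace ℝ (Fin n) | x i = x i'}) = 0 :=
    measure_iUnion_null fun i => measure_iUnion_null fun i' => measure_iUnion_null fun hi =>
      h.measure_coord_eq_coord hi
  rw [subgroupMeasure_apply] at hnull
  refine measure_mono_null ?_ hnull
  rintro x ⟨hσ, hτ⟩
  refine ⟨?_, hσ.2.1⟩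
  by_contra hcon
  simp only [Set.mem_iUnion, not_exists] at hcon
  refine hστ (eq_of_monotone_comp (x := fun i => x i) (fun i i' hii => ?_) hσ.2.2 hτ.2.2)
  by_contra hne
  exact hcon i i' hne hii

theorem IsGeneric.sum_measure_inter_chamber (h : IsGeneric A)
    {B : Set (EuclideanSpace ℝ (Fin n))} (hB : MeasurableSet B) :
    ∑ σ, μHE[n - t] (B ∩ chamber A σ) = subgroupMeasure (n - t) A (B ∩ closedCube n) := by
  rw [subgroupMeasure_apply, Set.inter_assoc, ← iUnion_chamber, Set.inter_iUnion,
    measure_iUnion₀ (fun σ τ hστ => (h.aedisjoint_chamber hστ).mono Set.inter_subset_right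
      Set.inter_subset_right)
      fun σ => (hB.inter (isClosed_chamber A σ).measurableSet).nullMeasurableSet, tsum_fintype]

theorem IsGeneric.measure_closedCube (h : IsGeneric A) :
    subgroupMeasure (n - t) A (closedCube n) = subgroupMeasure (n - t) A (unitCube n) := by
  refine le_antisymm ?_ (measure_mono fun x hx i => Set.Ico_subset_Icc_self (mem_unitCube.1 hx i))
  have hnull : subgroupMeasure (n - t) A (⋃ i, {x : EuclideanSpace ℝ (Fin n) | x i = 1}) = 0 :=
    measure_iUnion_null fun i => h.measure_coord_eq i 1
  have hsub : closedCube n ⊆ unitCube n ∪ ⋃ i, {x : EuclideanSpace ℝ (Fin n) | x i = 1} := by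
    intro x hx
    by_contra hcon
    simp only [Set.mem_union, not_or, Set.mem_iUnion, not_exists, mem_unitCube] at hcon
    exact hcon.1 fun i => ⟨(hx i).1, lt_of_le_of_ne (hx i).2 (hcon.2 i)⟩
  refine (measure_mono hsub).trans ((measure_union_le _ _).trans ?_)
  rw [hnull, add_zero]

end Generic

section Domain

variable {n t : ℕ} {m : Fin t → (Fin n → ℤ) × ℤ}

theorem IsGeneric.sum_measure_domain (h : IsGeneric fun j => (m j).1) :
    ∑ σ, μHE[n - t] (domain m σ) = subgroupMeasure (n - t) (fun j => (m j).1) (unitCube n) := by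
  have := h.sum_measure_inter_chamber MeasurableSet.univ
  rw [Set.univ_inter, h.measure_closedCube] at this
  rw [← this]
  refine Finset.sum_congr rfl fun σ _ => ?_
  have := euclideanHausdorffMeasure_inter_domain (n - t) m σ Set.univ
  simpa using this

theorem IsGeneric.measure_domain_ne_top (h : IsGeneric fun j => (m j).1)
    (σ : Equiv.Perm (Fin n)) : μHE[n - t] (domain m σ) ≠ ⊤ := by
  have h1 := subgroupMeasure_unitCube_ne_top h.linearIndependent
  rw [← h.sum_measure_domain] at h1
  exact (ENNReal.sum_ne_top.1 h1) σ (Finset.mem_univ _)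

theorem IsGeneric.measure_coord_eq_inter_domain (h : IsGeneric fun j => (m j).1)
    (σ : Equiv.Perm (Fin n)) (i : Fin n) (s : ℝ) :
    μHE[n - t] ({x | x i = s} ∩ domain m σ) = 0 := by
  rw [euclideanHausdorffMeasure_inter_domain]
  have h1 := h.measure_coord_eq (σ.symm i) s
  rw [subgroupMeasure_apply] at h1
  refine measure_mono_null (t := {x | x (σ.symm i) = s} ∩ _) (fun x hx => ⟨?_, hx.2.2.1⟩) h1
  have := hx.1
  simpa only [Set.mem_preimage, Set.mem_ofPred_eq, permCoord_apply] using this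

theorem IsGeneric.vol_frontier_box (h : IsGeneric fun j => (m j).1)
    (σ : Equiv.Perm (Fin n)) (lo hi : Fin n → ℝ) :
    vol (n - t) (frontier (box lo hi) ∩ domain m σ) = 0 := by
  have : μHE[n - t] (frontier (box lo hi) ∩ domain m σ) = 0 := by
    refine measure_mono_null (Set.inter_subset_inter_left _ (frontier_box_subset lo hi)) ?_
    rw [Set.iUnion_inter]
    refine measure_iUnion_null fun i => ?_
    rw [Set.union_inter_distrib_right]
    exact measure_union_null (h.measure_coord_eq_inter_domain σ i _)
      (h.measure_coord_eq_inter_domain σ i _)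
  rw [vol, this, ENNReal.toReal_zero]

theorem IsGeneric.measure_slab_inter_domain_le (h : IsGeneric fun j => (m j).1)
    (σ : Equiv.Perm (Fin n)) (i : Fin n) {u w : ℝ} (hu : 0 ≤ u) (hw : w < 1) :
    μHE[n - t] (({x | x i ∈ Set.Icc u w} ∩ unitCube n) ∩ domain m σ) ≤
      ENNReal.ofReal (w - u) * subgroupMeasure (n - t) (fun j => (m j).1) (unitCube n) := by
  rw [euclideanHausdorffMeasure_inter_domain,
    ← subgroupMeasure_slab _ (subgroupMeasure_unitCube_ne_top h.linearIndependent) (σ.symm i)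
      (h.coord _) hu hw, subgroupMeasure_apply]
  refine measure_mono fun x hx => ⟨⟨?_, ?_⟩, hx.2.2.1⟩
  · have := hx.1.1
    simpa only [Set.mem_ofPred_eq, permCoord_apply] using this
  · have := mem_unitCube.1 hx.1.2
    rw [mem_unitCube]
    intro i
    have := this (σ i)
    simpa only [permCoord_apply, Equiv.symm_apply_apply] using this

end Domain

/-! ### Slabs and the boxes that approximate them -/

/-- The box `[0,η]ⁿ` with the `i`-th side replaced by `[u,w]`. -/
noncomputable def slabBox {n : ℕ} (i : Fin n) (u w η : ℝ) : Set (EuclideanSpace ℝ (Fin n)) :=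
  box (Function.update 0 i u) (Function.update (fun _ => η) i w)

theorem mem_slabBox {n : ℕ} {i : Fin n} {u w η : ℝ} {x : EuclideanSpace ℝ (Fin n)} :
    x ∈ slabBox i u w η ↔ x i ∈ Set.Icc u w ∧ ∀ j, j ≠ i → x j ∈ Set.Icc 0 η := by
  unfold slabBox box
  simp only [Set.mem_ofPred_eq]
  constructor
  · intro h
    refine ⟨by simpa using h i, fun j hj => ?_⟩
    simpa [Function.update_of_ne hj] using h j
  · rintro ⟨h1, h2⟩ j
    rcases eq_or_ne j i with rfl | hj
    · simpa using h1
    · simpa [Function.update_of_ne hj] using h2 j hj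

theorem slabBox_subset {n : ℕ} {i : Fin n} {u w η : ℝ} (hu : 0 ≤ u) (hw : w < 1) (hη : η < 1) :
    slabBox i u w η ⊆ unitCube n := by
  intro x hx
  rw [mem_slabBox] at hx
  refine mem_unitCube.2 fun j => ?_
  rcases eq_or_ne j i with rfl | hj
  · exact ⟨hu.trans hx.1.1, hx.1.2.trans_lt hw⟩
  · exact ⟨(hx.2 j hj).1, (hx.2 j hj).2.trans_lt hη⟩

theorem closure_interior_slabBox {n : ℕ} {i : Fin n} {u w η : ℝ} (huw : u < w) (hη : 0 < η) :
    slabBox i u w η = closure (interior (slabBox i u w η)) := by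
  refine closure_interior_box fun j => ?_
  rcases eq_or_ne j i with rfl | hj
  · simpa using huw
  · simpa [Function.update_of_ne hj] using hη

theorem permCoord_preimage_slabBox {n : ℕ} (σ : Equiv.Perm (Fin n)) (i : Fin n) (u w η : ℝ) :
    permCoord σ ⁻¹' slabBox i u w η = slabBox (σ.symm i) u w η := by
  rw [slabBox, permCoord_preimage_box, Function.update_comp_equiv, Function.update_comp_equiv]
  rfl

section Generic

variable {n t : ℕ} {A : Fin t → Fin n → ℤ}

theorem IsGeneric.measureReal_slab (h : IsGeneric A) (i : Fin n) {u w : ℝ} (hu : 0 ≤ u)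
    (huw : u ≤ w) (hw : w < 1) :
    ((subgroupMeasure (n - t) A).restrict (unitCube n)).real {x | x i ∈ Set.Icc u w} =
      (w - u) * (subgroupMeasure (n - t) A).real (unitCube n) := by
  rw [measureReal_restrict_apply' (measurableSet_unitCube n), measureReal_def,
    subgroupMeasure_slab A (subgroupMeasure_unitCube_ne_top h.linearIndependent) i (h.coord i)
    hu hw, ENNReal.toReal_mul, ENNReal.toReal_ofReal (by linarith), measureReal_def]

/-- Union bound: each condition `x j ≤ η` discards the fraction `1 - η` of the cube, and there are
`n` coordinates. Boxes with `η < 1` replace the full slab because the latter is not closed inside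
`[0,1)ⁿ`. -/
theorem IsGeneric.le_measureReal_slabBox (h : IsGeneric A) (i : Fin n) {u w η : ℝ} (hu : 0 ≤ u)
    (huw : u ≤ w) (hw : w < 1) (h0 : 0 ≤ η) (hη : η < 1) :
    ((w - u) - n * (1 - η)) * (subgroupMeasure (n - t) A).real (unitCube n) ≤
      (subgroupMeasure (n - t) A).real (slabBox i u w η) := by
  set L := (subgroupMeasure (n - t) A).real (unitCube n) with hL
  set ν := (subgroupMeasure (n - t) A).restrict (unitCube n) with hν
  have hfin : IsFiniteMeasure ν := by
    refine ⟨?_⟩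
    rw [hν, Measure.restrict_apply_univ]
    exact (subgroupMeasure_unitCube_ne_top h.linearIndependent).lt_top
  have hνuniv : ν.real Set.univ = L := by
    rw [hν, measureReal_restrict_apply_univ]
  have hbox : (subgroupMeasure (n - t) A).real (slabBox i u w η) = ν.real (slabBox i u w η) := by
    rw [hν, measureReal_restrict_apply' (measurableSet_unitCube n),
      Set.inter_eq_left.2 (slabBox_subset hu hw hη)]
  have hmeas : ∀ j : Fin n, MeasurableSet {x : EuclideanSpace ℝ (Fin n) | x j ∈ Set.Icc 0 η} :=
    fun j => (isClosed_Icc.preimage (by fun_prop :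
      Continuous fun x : EuclideanSpace ℝ (Fin n) => x j)).measurableSet
  have hcompl : ∀ j : Fin n,
      ν.real {x : EuclideanSpace ℝ (Fin n) | x j ∈ Set.Icc 0 η}ᶜ = (1 - η) * L := by
    intro j
    rw [measureReal_compl (hmeas j), hνuniv, h.measureReal_slab j le_rfl h0 hη]
    ring
  have hsub : {x : EuclideanSpace ℝ (Fin n) | x i ∈ Set.Icc u w} ⊆ slabBox i u w η ∪
      ⋃ j ∈ (Finset.univ : Finset (Fin n)), {x : EuclideanSpace ℝ (Fin n) | x j ∈ Set.Icc 0 η}ᶜ := by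
    intro x hx
    by_contra hcon
    simp only [Set.mem_union, not_or, Set.mem_iUnion, not_exists, Finset.mem_univ,
      Set.mem_compl_iff, not_not, mem_slabBox] at hcon
    exact hcon.1 ⟨hx, fun j _ => hcon.2 j trivial⟩
  have h1 := measureReal_mono (μ := ν) hsub (measure_ne_top _ _)
  have h2 := h1.trans ((measureReal_union_le _ _).trans
    (add_le_add_right (measureReal_biUnion_finset_le _ _) _))
  rw [h.measureReal_slab i hu huw hw] at h2
  simp only [hcompl, Finset.sum_const, Finset.card_univ, Fintype.card_fin, nsmul_eq_mul] at h2
  rw [hbox]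
  linarith

end Generic

section Domain

variable {n t : ℕ} {m : Fin t → (Fin n → ℤ) × ℤ}

theorem IsGeneric.sum_vol_domain (h : IsGeneric fun j => (m j).1) :
    ∑ σ, vol (n - t) (domain m σ) =
      (subgroupMeasure (n - t) (fun j => (m j).1)).real (unitCube n) := by
  rw [measureReal_def, ← h.sum_measure_domain,
    ENNReal.toReal_sum fun σ _ => h.measure_domain_ne_top σ]
  rfl

theorem IsGeneric.sum_vol_domain_pos (h : IsGeneric fun j => (m j).1) :
    0 < ∑ σ, vol (n - t) (domain m σ) := by
  rw [h.sum_vol_domain]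
  exact ENNReal.toReal_pos (subgroupMeasure_unitCube_ne_zero h.linearIndependent)
    (subgroupMeasure_unitCube_ne_top h.linearIndependent)

/-- Passing from the domain of `σ` to its chamber turns the box in direction `i` into the one in
direction `σ⁻¹ i`. After summation over `i` this is a mere reindexing; this is why uniformity is
obtained for the average over the roots. -/
theorem IsGeneric.sum_vol_slabBox_inter_domain (h : IsGeneric fun j => (m j).1) {u w η : ℝ}
    (hu : 0 ≤ u) (hw : w < 1) (hη : η < 1) :
    ∑ i, ∑ σ, vol (n - t) (slabBox i u w η ∩ domain m σ) =
      ∑ i, (subgroupMeasure (n - t) (fun j => (m j).1)).real (slabBox i u w η) := by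
  set A := fun j => (m j).1 with hA
  have hmeas : ∀ i : Fin n, MeasurableSet (slabBox i u w η) := fun i =>
    (isClosed_box _ _).measurableSet
  have hcube : ∀ i : Fin n, slabBox i u w η ∩ closedCube n = slabBox i u w η := fun i =>
    Set.inter_eq_left.2 fun x hx j =>
      Set.Ico_subset_Icc_self (mem_unitCube.1 (slabBox_subset hu hw hη hx) j)
  have hsum : ∀ i : Fin n, ∑ σ, (μHE[n - t] (slabBox i u w η ∩ chamber A σ)).toReal =
      (subgroupMeasure (n - t) A).real (slabBox i u w η) := by
    intro i
    have h1 := h.sum_measure_inter_chamber (hmeas i)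
    rw [hcube] at h1
    rw [measureReal_def, ← h1, ENNReal.toReal_sum]
    intro σ _
    refine ne_top_of_le_ne_top ?_ (measure_mono Set.inter_subset_right)
    have := h.measure_domain_ne_top σ
    rwa [← Set.univ_inter (domain m σ), euclideanHausdorffMeasure_inter_domain,
      Set.preimage_univ, Set.univ_inter] at this
  rw [← Finset.sum_congr rfl fun i _ => hsum i, Finset.sum_comm,
    Finset.sum_comm (f := fun i σ => (μHE[n - t] (slabBox i u w η ∩ chamber A σ)).toReal)]
  refine Finset.sum_congr rfl fun σ _ => ?_
  simp only [vol, euclideanHausdorffMeasure_inter_domain, permCoord_preimage_slabBox]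
  exact Equiv.sum_comp σ.symm fun i => (μHE[n - t] (slabBox i u w η ∩ chamber A σ)).toReal

theorem IsGeneric.le_sum_vol_slabBox (h : IsGeneric fun j => (m j).1) {u w η : ℝ}
    (hu : 0 ≤ u) (huw : u ≤ w) (hw : w < 1) (h0 : 0 ≤ η) (hη : η < 1) :
    n * ((w - u) - n * (1 - η)) * ∑ σ, vol (n - t) (domain m σ) ≤
      ∑ i, ∑ σ, vol (n - t) (slabBox i u w η ∩ domain m σ) := by
  rw [h.sum_vol_slabBox_inter_domain hu hw hη, h.sum_vol_domain]
  calc _ = ∑ _i : Fin n, ((w - u) - n * (1 - η)) *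
        (subgroupMeasure (n - t) (fun j => (m j).1)).real (unitCube n) := by
        simp; ring
    _ ≤ _ := Finset.sum_le_sum fun i _ => h.le_measureReal_slabBox i hu huw hw h0 hη

end Domain

/-! ### Relations among the roots and genericity -/

theorem IsRelationBasis.mem_span_iff {n t : ℕ} {α : Fin n → ℂ} {m : Fin t → (Fin n → ℤ) × ℤ}
    (hm : IsRelationBasis α m) (l : (Fin n → ℤ) × ℤ) :
    l ∈ Submodule.span ℤ (Set.range m) ↔ ∑ i, (l.1 i : ℂ) * α i = (l.2 : ℂ) := by
  rw [← SetLike.mem_coe, hm.span_eq]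
  rfl

theorem IsRelationBasis.relation {n t : ℕ} {α : Fin n → ℂ} {m : Fin t → (Fin n → ℤ) × ℤ}
    (hm : IsRelationBasis α m) (j : Fin t) : ∑ i, ((m j).1 i : ℂ) * α i = ((m j).2 : ℂ) :=
  (hm.mem_span_iff _).1 (Submodule.subset_span ⟨j, rfl⟩)

/-- A relation with all `lᵢ = 0` has `l₀ = 0`, so dropping the last entry is injective on the
lattice. -/
theorem IsRelationBasis.linearIndependent_fst {n t : ℕ} {α : Fin n → ℂ}
    {m : Fin t → (Fin n → ℤ) × ℤ} (hm : IsRelationBasis α m) :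
    LinearIndependent ℤ fun j => (m j).1 := by
  rw [Fintype.linearIndependent_iff]
  intro g hg
  refine Fintype.linearIndependent_iff.1 hm.linearIndependent g ?_
  have hmem : ∑ j, g j • m j ∈ Submodule.span ℤ (Set.range m) :=
    Submodule.sum_mem _ fun j _ => Submodule.smul_mem _ _ (Submodule.subset_span ⟨j, rfl⟩)
  rw [hm.mem_span_iff] at hmem
  have h1 : (∑ j, g j • m j).1 = 0 := by
    rw [Prod.fst_sum]; simpa using hg
  refine Prod.ext h1 ?_
  rw [h1] at hmem
  simp only [Pi.zero_apply, Int.cast_zero, zero_mul, Finset.sum_const_zero] at hmem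
  exact_mod_cast hmem.symm

/-- An integral linear form whose value at the roots is irrational does not vanish on the common
kernel of the relations. -/
theorem IsRelationBasis.exists_pairing_ne_zero {n t : ℕ} {α : Fin n → ℂ}
    {m : Fin t → (Fin n → ℤ) × ℤ} (hm : IsRelationBasis α m) (c : Fin n → ℤ)
    (hc : ∀ q : ℚ, ∑ i, (c i : ℂ) * α i ≠ q) :
    ∃ v, (∀ j, pairing (m j).1 v = 0) ∧ pairing c v ≠ 0 := by
  let P : (Fin n → ℤ) → (Fin n → ℚ) →ₗ[ℚ] ℚ := fun c => ∑ i, (c i : ℚ) • LinearMap.proj i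
  have hP : ∀ c x, P c x = ∑ i, (c i : ℚ) * x i := fun c x => by
    simp [P, LinearMap.sum_apply]
  have hcast : ∀ (c : Fin n → ℤ) (x : Fin n → ℚ),
      pairing c (WithLp.toLp 2 fun i => (x i : ℝ)) = (P c x : ℚ) := fun c x => by
    rw [hP, pairing_apply]; push_cast; rfl
  by_contra hcon
  push Not at hcon
  -- If the form vanished on the real kernel, it would vanish on the rational one and so be a
  -- rational combination of the relations; its value at the roots would then be rational.
  have hker : ⨅ j, LinearMap.ker (P (m j).1) ≤ LinearMap.ker (P c) := by
    intro x hx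
    simp only [Submodule.mem_iInf, LinearMap.mem_ker] at hx ⊢
    have := hcon (WithLp.toLp 2 fun i => (x i : ℝ)) fun j => by rw [hcast, hx j, Rat.cast_zero]
    rw [hcast] at this
    exact_mod_cast this
  obtain ⟨q, hq⟩ := (Submodule.mem_span_range_iff_exists_fun ℚ).1
    (FiniteDimensional.mem_span_of_iInf_ker_le_ker hker)
  have hqi : ∀ i, (c i : ℚ) = ∑ j, q j * (m j).1 i := by
    intro i
    have := congrArg (fun T : (Fin n → ℚ) →ₗ[ℚ] ℚ => T (Pi.single i 1)) hq
    simp only [LinearMap.sum_apply, LinearMap.smul_apply, hP, smul_eq_mul] at this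
    simpa [Pi.single_apply] using this.symm
  refine hc (∑ j, q j * (m j).2) ?_
  have hqi' : ∀ i, (c i : ℂ) = ∑ j, (q j : ℂ) * (m j).1 i := fun i => by
    have := congrArg (fun q : ℚ => (q : ℂ)) (hqi i)
    push_cast at this
    exact this
  push_cast
  simp only [hqi', ← hm.relation, Finset.sum_mul, Finset.mul_sum]
  rw [Finset.sum_comm]
  exact Finset.sum_congr rfl fun j _ => Finset.sum_congr rfl fun i _ => by ring

theorem IsRelationBasis.isGeneric {n t : ℕ} {α : Fin n → ℂ}
    {m : Fin t → (Fin n → ℤ) × ℤ} (hm : IsRelationBasis α m) (hrat : ∀ i, ∀ q : ℚ, α i ≠ q)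
    (hdiff : ∀ i j, i ≠ j → ∀ q : ℚ, α i - α j ≠ (q : ℂ)) :
    IsGeneric fun j => (m j).1 where
  linearIndependent := hm.linearIndependent_fst
  coord i := by
    obtain ⟨v, hv, hc⟩ := hm.exists_pairing_ne_zero (Pi.single i 1) fun q => by
      simpa [Pi.single_apply] using hrat i q
    exact ⟨v, hv, by simpa [pairing_apply, Pi.single_apply] using hc⟩
  coord_sub i i' hi := by
    obtain ⟨v, hv, hc⟩ := hm.exists_pairing_ne_zero (Pi.single i 1 - Pi.single i' 1) fun q => by
      simpa [Pi.single_apply, sub_mul] using hdiff i i' hi q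
    refine ⟨v, hv, fun h => hc ?_⟩
    simpa [pairing_apply, Pi.single_apply, sub_mul, sub_eq_zero] using h

/-! ### The number of admissible permutations -/

theorem monic_of_map_eq_prod {n : ℕ} {f : ℤ[X]} {α : Fin n → ℂ}
    (hα : f.map (Int.castRingHom ℂ) = ∏ i, (X - C (α i))) : f.Monic :=
  monic_of_injective (RingHom.injective_int (Int.castRingHom ℂ))
    (hα ▸ monic_prod_of_monic _ _ fun _ _ => monic_X_sub_C _)

theorem aeval_root_eq_zero {n : ℕ} {f : ℤ[X]} {α : Fin n → ℂ}
    (hα : f.map (Int.castRingHom ℂ) = ∏ i, (X - C (α i))) (i : Fin n) : aeval (α i) f = 0 := by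
  rw [aeval_def, ← eval_map, algebraMap_int_eq, hα, eval_prod]
  exact Finset.prod_eq_zero (Finset.mem_univ i) (by simp)

theorem root_ne_ratCast {n : ℕ} {f : ℤ[X]} {α : Fin n → ℂ}
    (hα : f.map (Int.castRingHom ℂ) = ∏ i, (X - C (α i))) (hrat : ∀ q : ℚ, aeval q f ≠ 0)
    (i : Fin n) (q : ℚ) : α i ≠ q := by
  intro h
  refine hrat q ?_
  have h1 := aeval_root_eq_zero hα i
  rw [h, show (q : ℂ) = algebraMap ℚ ℂ q from rfl, aeval_algebraMap_apply] at h1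
  exact (map_eq_zero _).1 h1

/-- The ideal generated by a nonzero integral element meets `ℤ` nontrivially. Hence such an element
lies only in primes above the finitely many divisors of `N`. -/
theorem exists_int_of_ne_zero {S : Type*} [CommRing S] [IsDomain S] [Algebra.IsIntegral ℤ S]
    [CharZero S] {b : S} (hb : b ≠ 0) :
    ∃ N : ℤ, N ≠ 0 ∧ ∀ I : Ideal S, b ∈ I → (N : S) ∈ I := by
  have h := Ideal.comap_ne_bot_of_integral_mem (R := ℤ) hb (Ideal.mem_span_singleton_self b)
    (Algebra.IsIntegral.isIntegral b)
  obtain ⟨N, hN, hN0⟩ := Submodule.exists_mem_ne_zero_of_ne_bot h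
  refine ⟨N, hN0, fun I hI => ?_⟩
  have hN' : (N : S) ∈ Ideal.span {b} := by simpa using hN
  exact (Ideal.span_singleton_le_iff_mem I).2 hI hN'

theorem localRoots_spec {n : ℕ} {f : ℤ[X]} {p : ℕ} (hp : p.Prime)
    (h : ∃ r : Fin n → ℤ, FactorsMod f p r) : IsLocalRoots f p (localRoots n f p) := by
  obtain ⟨s, hs⟩ := h
  have h1 := (hs.existsUnique hp).exists
  rw [localRoots, dif_pos h1]
  exact h1.choose_spec

/-- Two systems of roots of a product of linear factors over a domain agree up to a
permutation. -/
theorem exists_perm_of_prod_eq {n : ℕ} {k : Type*} [CommRing k] [IsDomain k] {a b : Fin n → k}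
    (h : ∏ i, (X - C (a i)) = ∏ i, (X - C (b i))) : ∃ σ : Equiv.Perm (Fin n), a = b ∘ σ := by
  classical
  have h1 := congrArg Polynomial.roots h
  rw [roots_prod _ _ (Finset.prod_ne_zero_iff.2 fun i _ => X_sub_C_ne_zero _),
    roots_prod _ _ (Finset.prod_ne_zero_iff.2 fun i _ => X_sub_C_ne_zero _)] at h1
  simp only [roots_X_sub_C, Multiset.bind_singleton] at h1
  have hcard : ∀ c, Fintype.card {i // a i = c} = Fintype.card {i // b i = c} := by
    intro c
    have h2 := congrArg (Multiset.count c) h1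
    rw [Multiset.count_map, Multiset.count_map] at h2
    rw [Fintype.card_subtype, Fintype.card_subtype]
    simp only [eq_comm (a := c)] at h2
    exact h2
  exact ⟨Equiv.ofFiberEquiv fun c => Fintype.equivOfCardEq (hcard c),
    funext fun i => (Equiv.ofFiberEquiv_map _ i).symm⟩

/-- The permutations `μ` such that all relations hold for the roots permuted by `μ`. -/
noncomputable def admissible {n t : ℕ} (α : Fin n → ℂ) (m : Fin t → (Fin n → ℤ) × ℤ) :
    Finset (Equiv.Perm (Fin n)) :=
  open Classical in {μ | ∀ j, ∑ i, ((m j).1 i : ℂ) * α (μ i) = (m j).2}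

open Classical in
-- Modulo a prime `Q` of the ring of algebraic integers above `p`, the roots reduce to the local
-- roots up to some permutation `σ₀`. Then `μ ↦ σ₀ μ` matches relations among the complex roots with
-- congruences modulo `p`, as long as no nonzero `β j μ` falls into `Q`; this excludes finitely many
-- `p`.
theorem exists_card_perm_eq {n t : ℕ} {f : ℤ[X]} {α : Fin n → ℂ}
    (hα : f.map (Int.castRingHom ℂ) = ∏ i, (X - C (α i))) (m : Fin t → (Fin n → ℤ) × ℤ) :
    ∃ p₀ : ℕ, ∀ p, p₀ < p → p.Prime → (∃ r : Fin n → ℤ, FactorsMod f p r) →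
      (Finset.univ.filter fun σ : Equiv.Perm (Fin n) =>
        ∀ j, (∑ i, (m j).1 i * localRoots n f p (σ i)) ≡ (m j).2 [ZMOD p]).card =
      (admissible α m).card := by
  let S := integralClosure ℤ ℂ
  have hint : ∀ i, IsIntegral ℤ (α i) := fun i =>
    ⟨f, monic_of_map_eq_prod hα, aeval_root_eq_zero hα i⟩
  let a : Fin n → S := fun i => ⟨α i, hint i⟩
  have ha : ∀ i, (a i : ℂ) = α i := fun _ => rfl
  let β : Fin t → Equiv.Perm (Fin n) → S := fun j μ => ∑ i, ((m j).1 i : S) * a (μ i) - (m j).2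
  have hβ : ∀ j μ, β j μ = 0 ↔ ∑ i, ((m j).1 i : ℂ) * α (μ i) = (m j).2 := by
    intro j μ
    rw [← Subtype.coe_inj]
    simp [β, ha, sub_eq_zero]
  have hex : ∀ j μ, ∃ N : ℤ, N ≠ 0 ∧ (β j μ ≠ 0 → ∀ I : Ideal S, β j μ ∈ I → (N : S) ∈ I) := by
    intro j μ
    by_cases h : β j μ = 0
    · exact ⟨1, one_ne_zero, fun h' => absurd h h'⟩
    · obtain ⟨N, hN, hI⟩ := exists_int_of_ne_zero h
      exact ⟨N, hN, fun _ => hI⟩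
  choose N hN0 hN using hex
  -- A prime exceeding the sum of all `|N j μ|` divides none of these nonzero integers.
  refine ⟨∑ j, ∑ μ, (N j μ).natAbs, fun p hp hprime hspl => ?_⟩
  have hpN : ∀ j μ, ¬ (p : ℤ) ∣ N j μ := by
    intro j μ hdvd
    have h1 : p ≤ (N j μ).natAbs :=
      Nat.le_of_dvd (Int.natAbs_pos.2 (hN0 j μ)) (Int.natCast_dvd.1 hdvd)
    have h2 : (N j μ).natAbs ≤ ∑ j, ∑ μ, (N j μ).natAbs :=
      (Finset.single_le_sum (f := fun μ => (N j μ).natAbs) (fun _ _ => Nat.zero_le _)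
        (Finset.mem_univ μ)).trans
        (Finset.single_le_sum (f := fun j => ∑ μ, (N j μ).natAbs) (fun _ _ => Nat.zero_le _)
          (Finset.mem_univ j))
    omega
  have hpi : Prime (p : ℤ) := Nat.prime_iff_prime_int.1 hprime
  have hPp : (Ideal.span {(p : ℤ)}).IsPrime := (Ideal.span_singleton_prime hpi.ne_zero).2 hpi
  obtain ⟨Q, hQ, hQp⟩ := Ideal.exists_ideal_over_prime_of_isIntegral_of_isDomain (S := S)
    (Ideal.span {(p : ℤ)}) (by
      have : RingHom.ker (algebraMap ℤ S) = ⊥ :=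
        (RingHom.injective_iff_ker_eq_bot _).1 (algebraMap ℤ S).injective_int
      rw [this]; exact bot_le)
  have hmem : ∀ z : ℤ, (z : S) ∈ Q ↔ (p : ℤ) ∣ z := by
    intro z
    rw [← Ideal.mem_span_singleton, ← hQp, Ideal.mem_comap]
    simp
  let π := Ideal.Quotient.mk Q
  have hπ : ∀ z : ℤ, (z : S ⧸ Q) = 0 ↔ (p : ℤ) ∣ z := by
    intro z
    rw [← hmem, ← Ideal.Quotient.eq_zero_iff_mem, map_intCast]
  have hchar : CharP (S ⧸ Q) p := ⟨fun x => by
    have := hπ x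
    rw [Int.natCast_dvd_natCast] at this
    exact_mod_cast this⟩
  have hr := localRoots_spec hprime hspl
  set r := localRoots n f p with hrdef
  have h1 : f.map (Int.castRingHom (S ⧸ Q)) = ∏ i, (X - C ((r i : ℤ) : S ⧸ Q)) := by
    have := congrArg (Polynomial.map (ZMod.castHom dvd_rfl (S ⧸ Q))) hr.factors
    rw [Polynomial.map_map, Polynomial.map_prod,
      Subsingleton.elim (RingHom.comp _ _) (Int.castRingHom (S ⧸ Q))] at this
    simpa using this
  have h2 : f.map (Int.castRingHom S) = ∏ i, (X - C (a i)) := by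
    refine Polynomial.map_injective (algebraMap S ℂ) Subtype.val_injective ?_
    rw [Polynomial.map_map, Polynomial.map_prod,
      Subsingleton.elim (RingHom.comp _ _) (Int.castRingHom ℂ), hα]
    refine Finset.prod_congr rfl fun i _ => ?_
    simp only [Polynomial.map_sub, map_X, map_C]
    rfl
  have h3 : f.map (Int.castRingHom (S ⧸ Q)) = ∏ i, (X - C (π (a i))) := by
    have := congrArg (Polynomial.map π) h2
    rw [Polynomial.map_map, Polynomial.map_prod,
      Subsingleton.elim (RingHom.comp _ _) (Int.castRingHom (S ⧸ Q))] at this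
    simpa using this
  obtain ⟨σ₀, hσ₀⟩ := exists_perm_of_prod_eq (h3.symm.trans h1)
  have hσ₀' : ∀ i, π (a i) = ((r (σ₀ i) : ℤ) : S ⧸ Q) := fun i => congrFun hσ₀ i
  symm
  refine Finset.card_equiv (Equiv.mulLeft σ₀) fun μ => ?_
  simp only [admissible, Finset.mem_filter, Finset.mem_univ, true_and, Equiv.coe_mulLeft,
    Equiv.Perm.mul_apply]
  refine forall_congr' fun j => ?_
  rw [← hβ, Int.modEq_comm, Int.modEq_iff_dvd, ← hπ]
  have hval : (((∑ i, (m j).1 i * r (σ₀ (μ i)) - (m j).2 : ℤ)) : S ⧸ Q) = π (β j μ) := by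
    simp only [β, map_sub, map_sum, map_mul, hσ₀', map_intCast]
    push_cast
    rfl
  rw [hval, Ideal.Quotient.eq_zero_iff_mem]
  refine ⟨fun h => h ▸ Q.zero_mem, fun h => ?_⟩
  by_contra hne
  exact hpN j μ ((hmem _).1 (hN j μ hne Q h))

theorem card_admissible_pos {n t : ℕ} {α : Fin n → ℂ} {m : Fin t → (Fin n → ℤ) × ℤ}
    (hm : IsRelationBasis α m) : 0 < (admissible α m).card := by
  classical
  refine Finset.card_pos.2 ⟨1, ?_⟩
  simpa [admissible] using hm.relation

/-! ### Counting split primes -/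

section Counting

variable {n t : ℕ} {f : ℤ[X]} {m : Fin t → (Fin n → ℤ) × ℤ}

theorem mem_spl {x : ℝ} {p : ℕ} :
    p ∈ spl n f x ↔ p ≤ ⌊x⌋₊ ∧ p.Prime ∧ ∃ r : Fin n → ℤ, FactorsMod f p r := by
  simp [spl]

theorem mem_splPerm {σ : Equiv.Perm (Fin n)} {x : ℝ} {p : ℕ} :
    p ∈ splPerm f m σ x ↔ p ∈ spl n f x ∧
      ∀ j, (∑ i, (m j).1 i * localRoots n f p (σ i)) ≡ (m j).2 [ZMOD p] := by
  simp [splPerm]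

theorem splPerm_subset (σ : Equiv.Perm (Fin n)) (x : ℝ) : splPerm f m σ x ⊆ spl n f x :=
  fun _ hp => (mem_splPerm.1 hp).1

theorem spl_mono {x y : ℝ} (h : x ≤ y) : spl n f x ⊆ spl n f y := fun _ hp =>
  mem_spl.2 ⟨(mem_spl.1 hp).1.trans (Nat.floor_le_floor h), (mem_spl.1 hp).2⟩

theorem splPerm_mono (σ : Equiv.Perm (Fin n)) {x y : ℝ} (h : x ≤ y) :
    splPerm f m σ x ⊆ splPerm f m σ y := fun _ hp =>
  mem_splPerm.2 ⟨spl_mono h (mem_splPerm.1 hp).1, (mem_splPerm.1 hp).2⟩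

theorem prRatio_nonneg (σ : Equiv.Perm (Fin n)) (x : ℝ) : 0 ≤ prRatio f m σ x :=
  div_nonneg (Nat.cast_nonneg _) (Nat.cast_nonneg _)

theorem tendsto_prRatio (hlim : ∀ σ : Equiv.Perm (Fin n), ∃ q : ℝ,
    Tendsto (prRatio f m σ) atTop (𝓝 q)) (σ : Equiv.Perm (Fin n)) :
    Tendsto (prRatio f m σ) atTop (𝓝 (pr f m σ)) :=
  tendsto_nhds_limUnder (hlim σ)

theorem pr_nonneg (hlim : ∀ σ : Equiv.Perm (Fin n), ∃ q : ℝ,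
    Tendsto (prRatio f m σ) atTop (𝓝 q)) (σ : Equiv.Perm (Fin n)) : 0 ≤ pr f m σ :=
  ge_of_tendsto' (tendsto_prRatio hlim σ) fun x => prRatio_nonneg σ x

theorem vol_nonneg (d : ℕ) (S : Set (EuclideanSpace ℝ (Fin n))) : 0 ≤ vol d S :=
  ENNReal.toReal_nonneg

theorem vol_inter_domain_le (h : IsGeneric fun j => (m j).1) (σ : Equiv.Perm (Fin n))
    (D : Set (EuclideanSpace ℝ (Fin n))) :
    vol (n - t) (D ∩ domain m σ) ≤ vol (n - t) (domain m σ) :=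
  ENNReal.toReal_mono (h.measure_domain_ne_top σ) (measure_mono Set.inter_subset_right)

theorem rootPoint_apply (p : ℕ) (i : Fin n) : rootPoint n f p i = (localRoots n f p i : ℝ) / p :=
  rfl

theorem rootPoint_mem {x : ℝ} {p : ℕ} (hp : p ∈ spl n f x) (i : Fin n) :
    rootPoint n f p i ∈ Set.Icc 0 (1 - 1 / (p : ℝ)) := by
  obtain ⟨-, hprime, hspl⟩ := mem_spl.1 hp
  have h := localRoots_spec hprime hspl
  have hp0 : (0 : ℝ) < p := by exact_mod_cast hprime.pos
  rw [rootPoint_apply]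
  refine ⟨div_nonneg (by exact_mod_cast h.nonneg i) hp0.le, ?_⟩
  rw [le_sub_iff_add_le, ← add_div, div_le_one hp0]
  have := Int.add_one_le_of_lt (h.lt i)
  exact_mod_cast this

theorem slabBox_inter_domain_vol_le (h : IsGeneric fun j => (m j).1) (σ : Equiv.Perm (Fin n))
    (i : Fin n) {u w η : ℝ} (hu : 0 ≤ u) (huw : u ≤ w) (hw : w < 1) (hη : η < 1) :
    vol (n - t) (slabBox i u w η ∩ domain m σ) ≤
      (w - u) * ∑ σ, vol (n - t) (domain m σ) := by
  rw [h.sum_vol_domain, measureReal_def, ← ENNReal.toReal_ofReal (sub_nonneg.2 huw),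
    ← ENNReal.toReal_mul]
  refine ENNReal.toReal_mono (ENNReal.mul_ne_top ENNReal.ofReal_ne_top
    (subgroupMeasure_unitCube_ne_top h.linearIndependent)) ?_
  refine le_trans (measure_mono ?_) (h.measure_slab_inter_domain_le σ i hu hw)
  exact Set.inter_subset_inter_left _ fun x hx =>
    ⟨(mem_slabBox.1 hx).1, slabBox_subset hu hw hη hx⟩

open Classical in
/-- The second conjecture for the boxes `slabBox`. -/
theorem Conjecture2.tendsto_slabBox (h2 : Conjecture2 f m) (hn : 1 < n)
    (h : IsGeneric fun j => (m j).1) {σ : Equiv.Perm (Fin n)} (hσ : 0 < pr f m σ) (i : Fin n)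
    {u w η : ℝ} (hu : 0 ≤ u) (huw : u < w) (hw : w < 1) (h0 : 0 < η) (hη : η < 1) :
    Tendsto (fun x : ℝ => (({p ∈ splPerm f m σ x | rootPoint n f p ∈ slabBox i u w η}.card : ℝ)) /
        ((splPerm f m σ x).card : ℝ)) atTop
      (𝓝 (vol (n - t) (slabBox i u w η ∩ domain m σ) / vol (n - t) (domain m σ))) :=
  h2 hn σ hσ _ (closure_interior_slabBox huw h0)
    (fun _ hx => mem_unitCube.1 (slabBox_subset hu hw hη hx)) (h.vol_frontier_box σ _ _)

/-- Suppose `#Spl` stays below `b`. A single prime in `Spl(f, σ)` then contributes at least `1 / b`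
to the proportion for any box around its point, whereas Conjecture 2 gives an arbitrarily small
limit for thin boxes. -/
theorem tendsto_card_spl (hn : 1 < n) (h : IsGeneric fun j => (m j).1)
    (hlim : ∀ σ : Equiv.Perm (Fin n), ∃ q : ℝ, Tendsto (prRatio f m σ) atTop (𝓝 q))
    (hequiv : ∀ σ : Equiv.Perm (Fin n), 0 < pr f m σ ↔ 0 < vol (n - t) (domain m σ))
    (h2 : Conjecture2 f m) : Tendsto (fun x : ℝ => (spl n f x).card) atTop atTop := by
  classical
  refine tendsto_atTop_atTop_of_monotone (fun x y hxy => Finset.card_le_card (spl_mono hxy)) ?_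
  by_contra hcon
  push Not at hcon
  obtain ⟨b, hb⟩ := hcon
  obtain ⟨σ, -, hσ⟩ := Finset.exists_lt_of_sum_lt (s := Finset.univ)
    (f := fun _ : Equiv.Perm (Fin n) => (0 : ℝ)) (g := fun σ => vol (n - t) (domain m σ))
    (by simpa using h.sum_vol_domain_pos)
  have hpr := (hequiv σ).2 hσ
  obtain ⟨x₀, hx₀⟩ := ((tendsto_prRatio hlim σ).eventually (lt_mem_nhds hpr)).exists
  have hne : (splPerm f m σ x₀).Nonempty := by
    by_contra hemp
    rw [Finset.not_nonempty_iff_eq_empty] at hemp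
    simp [prRatio, hemp] at hx₀
  obtain ⟨p, hp⟩ := hne
  have hpt := rootPoint_mem (splPerm_subset _ _ hp)
  have hprime := (mem_spl.1 (splPerm_subset _ _ hp)).2.1
  have hp2 : (2 : ℝ) ≤ p := by exact_mod_cast hprime.two_le
  have hpinv : 0 < 1 / (p : ℝ) ∧ 1 / (p : ℝ) ≤ 1 / 2 :=
    ⟨by positivity, one_div_le_one_div_of_le two_pos hp2⟩
  obtain ⟨i⟩ : Nonempty (Fin n) := ⟨⟨0, by omega⟩⟩
  obtain ⟨y, hy⟩ : ∃ y, rootPoint n f p i = y := ⟨_, rfl⟩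
  have hyi := hy ▸ hpt i
  have hb0 : (0 : ℝ) < b := by exact_mod_cast (Nat.zero_le _).trans_lt (hb x₀)
  obtain ⟨V, hV⟩ : ∃ V, ∑ σ, vol (n - t) (domain m σ) = V := ⟨_, rfl⟩
  have hV0 : 0 < V := hV ▸ h.sum_vol_domain_pos
  -- The first bound keeps `y + δ < 1`, since `y ≤ 1 - 1 / p`. The second forces the limiting
  -- proportion of the box to be at most `1 / (2 * b)`.
  obtain ⟨δ, hδ0, h1, hδ2⟩ : ∃ δ : ℝ, 0 < δ ∧ δ ≤ 1 / (p : ℝ) / 2 ∧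
      δ ≤ vol (n - t) (domain m σ) / (2 * b * V) :=
    ⟨min (1 / (p : ℝ) / 2) (vol (n - t) (domain m σ) / (2 * b * V)),
      lt_min (by linarith) (by positivity), min_le_left _ _, min_le_right _ _⟩
  obtain ⟨η, hη⟩ : ∃ η : ℝ, 1 - 1 / (p : ℝ) = η := ⟨_, rfl⟩
  rw [hη] at hyi hpt
  have hyδ : y + δ < 1 := by linarith [hyi.2]
  have hη1 : η < 1 := by linarith
  have hη0 : 0 < η := by linarith
  have ht := h2.tendsto_slabBox hn h hpr i hyi.1 (lt_add_of_pos_right y hδ0) hyδ hη0 hη1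
  have hge : 1 / (b : ℝ) ≤ vol (n - t) (slabBox i y (y + δ) η ∩ domain m σ) /
      vol (n - t) (domain m σ) := by
    refine ge_of_tendsto ht ?_
    filter_upwards [eventually_ge_atTop x₀] with x hx
    have hmem := splPerm_mono σ hx hp
    have hc0 : (0 : ℝ) < (splPerm f m σ x).card := by
      exact_mod_cast Finset.card_pos.2 ⟨p, hmem⟩
    have hcb : ((splPerm f m σ x).card : ℝ) ≤ b := by
      exact_mod_cast (Finset.card_le_card (splPerm_subset σ x)).trans (hb x).le
    have hc1 : (1 : ℝ) ≤ ({p ∈ splPerm f m σ x |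
        rootPoint n f p ∈ slabBox i y (y + δ) η} : Finset ℕ).card := by
      have hpm : p ∈ ({p ∈ splPerm f m σ x |
          rootPoint n f p ∈ slabBox i y (y + δ) η} : Finset ℕ) := by
        refine Finset.mem_filter.2 ⟨hmem, mem_slabBox.2 ⟨?_, fun j _ => hpt j⟩⟩
        rw [hy]
        exact ⟨le_rfl, by linarith⟩
      exact_mod_cast Finset.card_pos.2 ⟨p, hpm⟩
    exact div_le_div₀ (by linarith) hc1 hc0 hcb
  have hle := slabBox_inter_domain_vol_le h σ i hyi.1 (le_add_of_nonneg_right hδ0.le) hyδ hη1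
  rw [div_le_div_iff₀ hb0 hσ] at hge
  rw [le_div_iff₀ (by positivity)] at hδ2
  rw [hV, add_sub_cancel_left] at hle
  have := mul_le_mul_of_nonneg_right hle hb0.le
  linarith

open Classical in
theorem sum_card_splPerm_filter (q : ℕ → Prop) (x : ℝ) :
    ∑ σ, ({p ∈ splPerm f m σ x | q p} : Finset ℕ).card =
      ∑ p ∈ spl n f x with q p, (Finset.univ.filter fun σ : Equiv.Perm (Fin n) =>
        ∀ j, (∑ i, (m j).1 i * localRoots n f p (σ i)) ≡ (m j).2 [ZMOD p]).card := by
  simp only [Finset.card_eq_sum_ones, Finset.sum_filter, splPerm]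
  rw [Finset.sum_comm]
  refine Finset.sum_congr rfl fun p _ => ?_
  by_cases hq : q p <;> simp [hq]

open Classical in
/-- Almost every prime of `spl` is counted by the same number of permutations. -/
theorem tendsto_sum_card_sub {α : Fin n → ℂ}
    (hα : f.map (Int.castRingHom ℂ) = ∏ i, (X - C (α i)))
    (hspl : Tendsto (fun x : ℝ => (spl n f x).card) atTop atTop) (q : ℕ → Prop) :
    Tendsto (fun x : ℝ => ∑ σ, (({p ∈ splPerm f m σ x | q p} : Finset ℕ).card : ℝ) /
        (spl n f x).card -
      (admissible α m).card * ((({p ∈ spl n f x | q p} : Finset ℕ).card : ℝ) /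
        (spl n f x).card)) atTop (𝓝 0) := by
  obtain ⟨p₀, hp₀⟩ := exists_card_perm_eq hα m
  set s := (admissible α m).card with hs
  set N : ℕ → ℕ := fun p => (Finset.univ.filter fun σ : Equiv.Perm (Fin n) =>
        ∀ j, (∑ i, (m j).1 i * localRoots n f p (σ i)) ≡ (m j).2 [ZMOD p]).card with hN
  -- Only primes up to `p₀` can have a count other than `s`; their total error is bounded by a
  -- constant, negligible against `#Spl`.
  set Cst : ℝ := ∑ p ∈ Finset.Iic p₀, |(N p : ℝ) - s| with hCst
  have hlim0 : Tendsto (fun x : ℝ => Cst / ((spl n f x).card : ℝ)) atTop (𝓝 0) :=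
    (tendsto_natCast_atTop_atTop.comp hspl).const_div_atTop Cst
  refine squeeze_zero_norm (fun x => ?_) hlim0
  have h1 : ∑ σ, (({p ∈ splPerm f m σ x | q p} : Finset ℕ).card : ℝ) =
      ∑ p ∈ spl n f x with q p, (N p : ℝ) := by
    exact_mod_cast sum_card_splPerm_filter q x
  rw [← Finset.sum_div, h1, ← mul_div_assoc, ← sub_div, norm_div, Real.norm_natCast]
  refine div_le_div_of_nonneg_right ?_ (Nat.cast_nonneg _)
  have h2 : ∑ p ∈ spl n f x with q p, (N p : ℝ) -
      s * (({p ∈ spl n f x | q p} : Finset ℕ).card : ℝ) =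
      ∑ p ∈ spl n f x with q p, ((N p : ℝ) - s) := by
    rw [Finset.sum_sub_distrib, Finset.sum_const, nsmul_eq_mul, mul_comm]
  rw [h2, Real.norm_eq_abs]
  refine (Finset.abs_sum_le_sum_abs _ _).trans ?_
  rw [← Finset.sum_filter_ne_zero]
  refine Finset.sum_le_sum_of_subset_of_nonneg (fun p hp => ?_) fun _ _ _ => abs_nonneg _
  obtain ⟨hp, hne⟩ := Finset.mem_filter.1 hp
  by_contra hgt
  rw [Finset.mem_Iic, not_le] at hgt
  obtain ⟨-, hprime, hr⟩ := mem_spl.1 (Finset.mem_filter.1 hp).1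
  refine hne ?_
  rw [show N p = s from hp₀ p hgt hprime hr, sub_self, abs_zero]

open Classical in
/-- The points `(r₁/p, …, rₙ/p)` are equidistributed with respect to the sum of the measures on
the domains. -/
theorem tendsto_card_slabBox {α : Fin n → ℂ}
    (hα : f.map (Int.castRingHom ℂ) = ∏ i, (X - C (α i)))
    (hm : IsRelationBasis α m) (hn : 1 < n) (h : IsGeneric fun j => (m j).1)
    (hlim : ∀ σ : Equiv.Perm (Fin n), ∃ q : ℝ, Tendsto (prRatio f m σ) atTop (𝓝 q))
    (hequiv : ∀ σ : Equiv.Perm (Fin n), 0 < pr f m σ ↔ 0 < vol (n - t) (domain m σ))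
    (h1 : Conjecture1 f m) (h2 : Conjecture2 f m) (i : Fin n)
    {u w η : ℝ} (hu : 0 ≤ u) (huw : u < w) (hw : w < 1) (h0 : 0 < η) (hη : η < 1) :
    Tendsto (fun x : ℝ =>
        (({p ∈ spl n f x | rootPoint n f p ∈ slabBox i u w η} : Finset ℕ).card : ℝ) /
          (spl n f x).card) atTop
      (𝓝 ((∑ σ, vol (n - t) (slabBox i u w η ∩ domain m σ)) /
        ∑ σ, vol (n - t) (domain m σ))) := by
  have hspl := tendsto_card_spl hn h hlim hequiv h2
  have hs : (0 : ℝ) < (admissible α m).card := by exact_mod_cast card_admissible_pos hm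
  obtain ⟨⟨c, hc⟩, -⟩ := h1
  -- Conjecture 1 covers only positive densities; where the density is zero, `hequiv` makes the
  -- volume vanish too.
  have hvol : ∀ σ, vol (n - t) (domain m σ) = c * pr f m σ := by
    intro σ
    rcases (pr_nonneg hlim σ).eq_or_lt with h0 | hpos
    · rw [← h0, mul_zero]
      have := (hequiv σ).not.1 (by rw [← h0]; exact lt_irrefl _)
      exact le_antisymm (not_lt.1 this) (vol_nonneg _ _)
    · rw [← hc σ hpos, div_mul_cancel₀ _ hpos.ne']
  have hV := h.sum_vol_domain_pos
  have hsum : ∑ σ, vol (n - t) (domain m σ) = c * ∑ σ, pr f m σ := by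
    rw [Finset.mul_sum]; exact Finset.sum_congr rfl fun σ _ => hvol σ
  have hc0 : c ≠ 0 := by
    rintro rfl
    rw [hsum, zero_mul] at hV
    exact lt_irrefl _ hV
  -- The count with the trivial predicate: almost every prime of `Spl` is counted `s` times, so the
  -- densities add up to `s` and not to one.
  have hprsum : ∑ σ, pr f m σ = (admissible α m).card := by
    have ht1 := tendsto_finsetSum (Finset.univ : Finset (Equiv.Perm (Fin n)))
      fun σ _ => tendsto_prRatio hlim σ
    have ht2 := tendsto_sum_card_sub (m := m) hα hspl fun _ => True
    have ht3 := ht1.sub ht2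
    rw [sub_zero] at ht3
    refine tendsto_nhds_unique ht3 (tendsto_const_nhds.congr' ?_)
    filter_upwards [hspl.eventually_gt_atTop 0] with x hx
    have : ((spl n f x).card : ℝ) ≠ 0 := by exact_mod_cast hx.ne'
    simp [prRatio, this]
  have hσ : ∀ σ, Tendsto (fun x : ℝ =>
      (({p ∈ splPerm f m σ x | rootPoint n f p ∈ slabBox i u w η} : Finset ℕ).card : ℝ) /
        (spl n f x).card) atTop (𝓝 (vol (n - t) (slabBox i u w η ∩ domain m σ) / c)) := by
    intro σ
    rcases (pr_nonneg hlim σ).eq_or_lt with hz | hpos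
    · have hv0 : vol (n - t) (slabBox i u w η ∩ domain m σ) = 0 := by
        refine le_antisymm ((vol_inter_domain_le h σ _).trans ?_) (vol_nonneg _ _)
        rw [hvol, ← hz, mul_zero]
      rw [hv0, zero_div]
      refine squeeze_zero (fun x => by positivity) (fun x => ?_) (hz ▸ tendsto_prRatio hlim σ)
      exact div_le_div_of_nonneg_right
        (by exact_mod_cast Finset.card_le_card (Finset.filter_subset _ _)) (Nat.cast_nonneg _)
    · have ht := (h2.tendsto_slabBox hn h hpos i hu huw hw h0 hη).mul (tendsto_prRatio hlim σ)
      rw [hvol σ, mul_comm c, ← div_div, div_right_comm, div_mul_cancel₀ _ hpos.ne'] at ht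
      refine ht.congr fun x => ?_
      rw [prRatio]
      -- The factor `#Spl(f, σ)` cancels unless it is zero, in which case both sides are zero.
      rcases eq_or_ne ((splPerm f m σ x).card : ℝ) 0 with hz | hnz
      · have hz' : splPerm f m σ x = ∅ := by
          rw [← Finset.card_eq_zero]; exact_mod_cast hz
        simp [hz']
      · rw [div_mul_div_cancel₀ hnz]
  have ht1 := tendsto_finsetSum (Finset.univ : Finset (Equiv.Perm (Fin n))) fun σ _ => hσ σ
  have ht2 := tendsto_sum_card_sub (m := m) hα hspl fun p => rootPoint n f p ∈ slabBox i u w η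
  have ht3 := (ht1.sub ht2).div_const ((admissible α m).card : ℝ)
  rw [sub_zero, ← Finset.sum_div, div_div] at ht3
  rw [hsum, hprsum]
  refine ht3.congr fun x => ?_
  rw [sub_sub_cancel, mul_div_cancel_left₀ _ hs.ne']

end Counting

/-! ### Averaging over the roots -/

section Average

variable {n t : ℕ} {f : ℤ[X]} {m : Fin t → (Fin n → ℤ) × ℤ}

/-- The proportion of the quotients `rᵢ / p` that lie in `S`. -/
noncomputable def proportion (n : ℕ) (f : ℤ[X]) (S : Set ℝ) [DecidablePred (· ∈ S)] (x : ℝ) : ℝ :=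
  ((∑ p ∈ spl n f x, (Finset.univ.filter fun i : Fin n =>
    (localRoots n f p i : ℝ) / p ∈ S).card : ℕ) : ℝ) / ((n : ℝ) * ((spl n f x).card : ℝ))

theorem proportion_nonneg (S : Set ℝ) [DecidablePred (· ∈ S)] (x : ℝ) :
    0 ≤ proportion n f S x := by
  unfold proportion
  positivity

theorem proportion_mono {S T : Set ℝ} [DecidablePred (· ∈ S)] [DecidablePred (· ∈ T)]
    (h : S ⊆ T) (x : ℝ) : proportion n f S x ≤ proportion n f T x := by
  unfold proportion
  refine div_le_div_of_nonneg_right ?_ (by positivity)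
  exact_mod_cast Finset.sum_le_sum fun p _ => Finset.card_le_card fun i hi => by
    simp only [Finset.mem_filter, Finset.mem_univ, true_and] at hi ⊢
    exact h hi

theorem proportion_add_le_one {S T : Set ℝ} [DecidablePred (· ∈ S)] [DecidablePred (· ∈ T)]
    (h : Disjoint S T) (x : ℝ) : proportion n f S x + proportion n f T x ≤ 1 := by
  unfold proportion
  rw [← add_div]
  refine div_le_one_of_le₀ ?_ (by positivity)
  rw [← Nat.cast_add, ← Nat.cast_mul, ← Finset.sum_add_distrib, Nat.cast_le, mul_comm,
    ← smul_eq_mul, ← Finset.sum_const]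
  refine Finset.sum_le_sum fun p _ => ?_
  rw [← Finset.card_union_of_disjoint]
  · exact (Finset.card_le_univ _).trans_eq (Fintype.card_fin n)
  · rw [Finset.disjoint_filter]
    exact fun i _ h1 h2 => Set.disjoint_left.1 h h1 h2

open Classical in
theorem sum_card_slabBox_le_proportion (u w η x : ℝ) :
    (∑ i, (({p ∈ spl n f x | rootPoint n f p ∈ slabBox i u w η} : Finset ℕ).card : ℝ) /
      (spl n f x).card) / n ≤ proportion n f (Set.Icc u w) x := by
  unfold proportion
  rw [← Finset.sum_div, div_div, mul_comm ((spl n f x).card : ℝ)]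
  refine div_le_div_of_nonneg_right ?_ (by positivity)
  rw [← Nat.cast_sum, Nat.cast_le]
  simp only [Finset.card_eq_sum_ones, Finset.sum_filter]
  rw [Finset.sum_comm]
  refine Finset.sum_le_sum fun p _ => Finset.sum_le_sum fun i _ => ?_
  split_ifs with h1 h2
  · exact le_rfl
  · exact absurd (mem_slabBox.1 h1).1 h2
  · exact Nat.zero_le _
  · exact le_rfl

theorem eventually_lt_proportion {α : Fin n → ℂ}
    (hα : f.map (Int.castRingHom ℂ) = ∏ i, (X - C (α i)))
    (hm : IsRelationBasis α m) (hn : 1 < n) (h : IsGeneric fun j => (m j).1)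
    (hlim : ∀ σ : Equiv.Perm (Fin n), ∃ q : ℝ, Tendsto (prRatio f m σ) atTop (𝓝 q))
    (hequiv : ∀ σ : Equiv.Perm (Fin n), 0 < pr f m σ ↔ 0 < vol (n - t) (domain m σ))
    (h1 : Conjecture1 f m) (h2 : Conjecture2 f m)
    {u w b : ℝ} (hu : 0 ≤ u) (huw : u < w) (hw : w < 1) (hb : b < w - u) :
    ∀ᶠ x in atTop, b < proportion n f (Set.Icc u w) x := by
  classical
  have hn0 : (0 : ℝ) < n := by exact_mod_cast zero_lt_one.trans hn
  obtain ⟨ε, hε0, hε1, hεb⟩ : ∃ ε : ℝ, 0 < ε ∧ ε < 1 ∧ n * ε < w - u - b := by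
    -- With `η = 1 - ε` the boxes lose at most `n * ε` of the slab, which fits into the slack `w - u
    -- - b`.
    have hd : 0 < (w - u - b) / n := div_pos (by linarith) hn0
    obtain ⟨ε, h0, hlt⟩ := exists_between (lt_min one_pos hd)
    refine ⟨ε, h0, hlt.trans_le (min_le_left _ _), ?_⟩
    have := (lt_div_iff₀ hn0).1 (hlt.trans_le (min_le_right _ _))
    linarith
  have hη0 : 0 < 1 - ε := by linarith
  have hη1 : 1 - ε < 1 := by linarith
  have ht := (tendsto_finsetSum Finset.univ fun i _ => tendsto_card_slabBox hα hm hn h hlim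
    hequiv h1 h2 i hu huw hw hη0 hη1).div_const (n : ℝ)
  have hlow := h.le_sum_vol_slabBox hu huw.le hw hη0.le hη1
  have hV := h.sum_vol_domain_pos
  rw [← Finset.sum_div] at ht
  refine (ht.eventually (lt_mem_nhds (a := b) ?_)).mono fun x hx =>
    hx.trans_le (sum_card_slabBox_le_proportion u w (1 - ε) x)
  rw [lt_div_iff₀ hn0, lt_div_iff₀ hV]
  refine lt_of_lt_of_le ?_ hlow
  refine mul_lt_mul_of_pos_right ?_ hV
  rw [mul_comm]
  refine mul_lt_mul_of_pos_left ?_ hn0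
  linarith

/-- The lower bound comes from `[0, w]` with `w < a`. The upper bound comes from the lower bound for
an interval to the right of `a`, since disjoint sets have total proportion at most one. -/
theorem tendsto_proportion_Iic {α : Fin n → ℂ}
    (hα : f.map (Int.castRingHom ℂ) = ∏ i, (X - C (α i)))
    (hm : IsRelationBasis α m) (hn : 1 < n) (h : IsGeneric fun j => (m j).1)
    (hlim : ∀ σ : Equiv.Perm (Fin n), ∃ q : ℝ, Tendsto (prRatio f m σ) atTop (𝓝 q))
    (hequiv : ∀ σ : Equiv.Perm (Fin n), 0 < pr f m σ ↔ 0 < vol (n - t) (domain m σ))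
    (h1 : Conjecture1 f m) (h2 : Conjecture2 f m) {a : ℝ} (ha : a ∈ Set.Icc (0 : ℝ) 1)
    [DecidablePred (· ∈ Set.Iic a)] :
    Tendsto (proportion n f (Set.Iic a)) atTop (𝓝 a) := by
  have hevent : ∀ {u w b : ℝ}, 0 ≤ u → u < w → w < 1 → b < w - u →
      ∀ᶠ x in atTop, b < proportion n f (Set.Icc u w) x := fun hu huw hw hb =>
    eventually_lt_proportion hα hm hn h hlim hequiv h1 h2 hu huw hw hb
  refine tendsto_order.2 ⟨fun b hb => ?_, fun b hb => ?_⟩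
  · rcases lt_or_ge b 0 with hb0 | hb0
    · exact Eventually.of_forall fun x => hb0.trans_le (proportion_nonneg _ x)
    · obtain ⟨w, hbw, hwa⟩ := exists_between hb
      refine (hevent le_rfl (hb0.trans_lt hbw) (hwa.trans_le ha.2) (by rwa [sub_zero])).mono
        fun x hx => hx.trans_le (proportion_mono (fun y hy => hy.2.trans hwa.le) x)
  · rcases ha.2.eq_or_lt with rfl | ha1
    · exact Eventually.of_forall fun x => lt_of_le_of_lt
        (by simpa [proportion] using
          proportion_add_le_one (n := n) (f := f) (Set.disjoint_empty (Set.Iic (1 : ℝ))) x) hb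
    · obtain ⟨δ, hδ0, hδ⟩ := exists_between (lt_min (sub_pos.2 hb) (sub_pos.2 ha1))
      have hδ1 := hδ.trans_le (min_le_left _ _)
      have hδ2 := hδ.trans_le (min_le_right _ _)
      -- This interval has length `1 - a - δ / 2`, which exceeds `1 - b` because `δ < b - a`.
      refine (hevent (u := a + δ / 4) (w := 1 - δ / 4) (b := 1 - b) (by linarith [ha.1])
        (by linarith) (by linarith) (by linarith)).mono fun x hx => ?_
      have hdisj : Disjoint (Set.Iic a) (Set.Icc (a + δ / 4) (1 - δ / 4)) := by
        rw [Set.disjoint_left]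
        intro y hy hy'
        have := hy'.1
        have : y ≤ a := hy
        linarith
      have := proportion_add_le_one (n := n) (f := f) hdisj x
      linarith

/-- A monic integral polynomial of degree one has the integral root `-f(0)`. This supplies the
condition `1 < n` of Conjecture 2. -/
theorem one_lt_of_forall_aeval_ne_zero (hn : 0 < n) {α : Fin n → ℂ}
    (hα : f.map (Int.castRingHom ℂ) = ∏ i, (X - C (α i))) (hrat : ∀ q : ℚ, aeval q f ≠ 0) :
    1 < n := by
  by_contra hcon
  obtain rfl : n = 1 := by omega
  refine root_ne_ratCast hα hrat 0 (-(f.coeff 0 : ℚ)) ?_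
  have := congrArg (fun g : ℂ[X] => g.coeff 0) hα
  simp only [coeff_map, Finset.univ_unique, Fin.default_eq_zero, Finset.prod_singleton, coeff_sub,
    coeff_X_zero, coeff_C_zero, zero_sub, eq_intCast] at this
  push_cast
  rw [this, neg_neg]

end Average

end LocalRoots

theorem mainTheorem3 {n t : ℕ} (hn : 0 < n) (f : ℤ[X]) (α : Fin n → ℂ)
    (hα : f.map (Int.castRingHom ℂ) = ∏ i, (X - C (α i)))
    (m : Fin t → (Fin n → ℤ) × ℤ) (hm : LocalRoots.IsRelationBasis α m)
    (hlim : ∀ σ : Equiv.Perm (Fin n), ∃ q : ℝ, Tendsto (LocalRoots.prRatio f m σ) atTop (𝓝 q))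
    (hrat : ∀ q : ℚ, aeval q f ≠ 0)
    (hdiff : ∀ i j, i ≠ j → ∀ q : ℚ, α i - α j ≠ (q : ℂ))
    (hequiv : ∀ σ : Equiv.Perm (Fin n), 0 < LocalRoots.pr f m σ ↔
      0 < LocalRoots.vol (n - t) (LocalRoots.domain m σ))
    (h1 : LocalRoots.Conjecture1 f m) (h2 : LocalRoots.Conjecture2 f m)
    (a : ℝ) (ha : a ∈ Set.Icc (0 : ℝ) 1) :
    Tendsto (fun x : ℝ =>
        ((∑ p ∈ LocalRoots.spl n f x,
            (Finset.univ.filter fun i : Fin n =>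
              (LocalRoots.localRoots n f p i : ℝ) / p ≤ a).card : ℕ) : ℝ) /
          ((n : ℝ) * ((LocalRoots.spl n f x).card : ℝ)))
      atTop (𝓝 a) := by
  have : DecidablePred (· ∈ Set.Iic a) := fun y => Real.decidableLE y a
  have := LocalRoots.tendsto_proportion_Iic hα hm
    (LocalRoots.one_lt_of_forall_aeval_ne_zero hn hα hrat)
    (hm.isGeneric (LocalRoots.root_ne_ratCast hα hrat) hdiff) hlim hequiv h1 h2 ha
  refine this.congr fun x => ?_
  simp only [LocalRoots.proportion, Set.mem_Iic]
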